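/- Notation. For complex $a$ and an integer $k\ge 0$ let $(a)_k=(a;q)_k=\prod_{i=0}^{k-1}(1-aq^i)$ and $(a_1,\dots,a_m)_k=(a_1)_k\cdots(a_m)_k$. For multi-indices $\boldsymbol k=(k_1,\dots,k_n)$ of non-negative integers let $|\boldsymbol k|=k_1+\dots+k_n$; $\boldsymbol j\le\boldsymbol k$ means $0\le j_r\le k_r$ for all $r$. Put $$V(\boldsymbol k)=\prod_{1\le r<s\le n}\frac{1-q^{k_r-k_s}x_r/x_s}{1-x_r/x_s}.$$ Theorem. Let $q\in\mathbb C$, $0<|q|<1$, let $x_1,\dots,x_n$ be non-zero complex numbers, $\boldsymbol N=(N_1,\dots,N_n)$ non-negative integers, $a,b,A$ non-zero complex numbers, and let $\beta(\boldsymbol j)$ be arbitrary complex numbers. Assume that none of the denominators in the following identity (and in $V$) vanishes. Then $$\prod_{r=1}^n\frac{(Ax_r,aqx_r)_{N_r}}{(aAx_r/b,bqx_r)_{N_r}}\sum_{\boldsymbol j\le\boldsymbol N}V(\boldsymbol j)\prod_{r,s=1}^n\Big(q^{-N_s}\frac{x_r}{x_s}\Big)_{j_r}\prod_{r=1}^n\frac{1-bx_rq^{j_r+|\boldsymbol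 j|}}{(1-bx_r)(bx_rq^{1+N_r})_{|\boldsymbol j|}}\;q^{|\boldsymbol j||\boldsymbol N|+\sum_r(r-1)j_r}\beta(\boldsymbol j)$$ $$=\sum_{\boldsymbol k\le\boldsymbol N}V(\boldsymbol k)\prod_{r,s=1}^n\frac{(q^{-N_s}x_r/x_s)_{k_r}}{(qx_r/x_s)_{k_r}}\prod_{r=1}^n\frac{1-ax_rq^{k_r+|\boldsymbol k|}}{1-ax_r}\prod_{r=1}^n\frac{(ax_r)_{|\boldsymbol k|}}{(ax_rq^{1+N_r})_{|\boldsymbol k|}(bqx_r,aAx_r/b)_{k_r}}$$ $$\times(a/b,bq/A)_{|\boldsymbol k|}\,(Aq^{|\boldsymbol N|})^{|\boldsymbol k|}\,q^{\sum_r(r-1)k_r-\sum_{r<s}k_rk_s}\prod_{r=1}^nx_r^{k_r}$$ $$\times\sum_{\boldsymbol j\le\boldsymbol k}V(\boldsymbol j)\prod_{r,s=1}^n\Big(q^{-k_s}\frac{x_r}{x_s}\Big)_{j_r}\prod_{r=1}^n\frac{(1-bx_rq^{j_r+|\boldsymbol j|})(ax_rq^{|\boldsymbol k|},Ax_r)_{j_r}}{(1-bx_r)(bx_rq^{k_r+1})_{|\boldsymbol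 j|}}\;\frac{(bq/aA)^{|\boldsymbol j|}}{(bq/A,\,bq^{1-|\boldsymbol k|}/a)_{|\boldsymbol j|}}\,q^{\sum_r(r-1)j_r+\sum_{r<s}j_rj_s}\prod_{r=1}^nx_r^{-j_r}\,\beta(\boldsymbol j).$$ In particular the identity contains (take $\beta(\boldsymbol j)=\prod_r\delta_{j_r,0}$, replace $b$ by $a/b$ and $A$ by $aq/bc$) Milne's $A_n$ terminating very-well-poised ${}_6\phi_5$ sum: for complex $a$ and non-zero complex $b,c$ for which no denominator below vanishes, $$\prod_{r=1}^n\frac{(aqx_r/bc,aqx_r)_{N_r}}{(aqx_r/b,aqx_r/c)_{N_r}}=\sum_{\boldsymbol k\le\boldsymbol N}V(\boldsymbol k)\prod_{r,s=1}^n\frac{(q^{-N_s}x_r/x_s)_{k_r}}{(qx_r/x_s)_{k_r}}\prod_{r=1}^n\frac{1-ax_rq^{k_r+|\boldsymbol k|}}{1-ax_r}$$ $$\times\prod_{r=1}^n\frac{(ax_r)_{|\boldsymbol k|}}{(ax_rq^{1+N_r})_{|\boldsymbol k|}(aqx_r/b,aqx_r/c)_{k_r}}\;(b,c)_{|\boldsymbol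 k|}\Big(\frac{aq^{1+|\boldsymbol N|}}{bc}\Big)^{|\boldsymbol k|}q^{\sum_r(r-1)k_r-\sum_{r<s}k_rk_s}\prod_{r=1}^nx_r^{k_r}.$$ -/

import Mathlib

namespace AnSeries

/-- The `q`-rising factorial `(a; q)_k = (1 - a)(1 - a q) ⋯ (1 - a q^(k-1))`. -/
def qPoch (q a : ℂ) (k : ℕ) : ℂ := ∏ i ∈ Finset.range k, (1 - a * q ^ i)

/-- `|k| = k_1 + ⋯ + k_n`. -/
def size {n : ℕ} (k : Fin n → ℕ) : ℕ := ∑ r, k r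

/-- The second elementary symmetric function `∑_{r < s} k_r k_s`. -/
def pairSum {n : ℕ} (k : Fin n → ℕ) : ℕ := ∑ r, ∑ s ∈ Finset.Ioi r, k r * k s

/-- `∑_{r=1}^n (r - 1) k_r`; the value of `r : Fin n` is the 1-based index minus one. -/
def weight {n : ℕ} (k : Fin n → ℕ) : ℕ := ∑ r : Fin n, (r : ℕ) * k r

/-- The Vandermonde factor of type `A`:
`∏_{r < s} (1 - q^(k_r - k_s) x_r / x_s) / (1 - x_r / x_s)`. -/
noncomputable def vandermonde {n : ℕ} (q : ℂ) (x : Fin n → ℂ) (k : Fin n → ℕ) : ℂ :=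
  ∏ r, ∏ s ∈ Finset.Ioi r,
    (1 - q ^ ((k r : ℤ) - (k s : ℤ)) * (x r / x s)) / (1 - x r / x s)

/-- `∏_{r,s=1}^n (q^(-N_s) x_r / x_s; q)_{k_r}`. -/
noncomputable def lowerProd {n : ℕ} (q : ℂ) (x : Fin n → ℂ) (N k : Fin n → ℕ) : ℂ :=
  ∏ r, ∏ s, qPoch q (q ^ (-(N s : ℤ)) * (x r / x s)) (k r)

/-- `∏_{r,s=1}^n (q x_r / x_s; q)_{k_r}`. -/
noncomputable def upperProd {n : ℕ} (q : ℂ) (x : Fin n → ℂ) (k : Fin n → ℕ) : ℂ :=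
  ∏ r, ∏ s, qPoch q (q * (x r / x s)) (k r)

end AnSeries

/-!
The sum over `k` on the right-hand side is carried out first, for fixed `j`. Writing `k = j + k'`,
it becomes Milne's `6φ5` sum with `a`, `b`, `c`, `x_r` replaced by `a q^|j|`, `a / b`,
`b q^(1 + |j|) / A`, `x_r q^(j_r)` (`inner_sum`); so the transformation follows from the `6φ5` sum.

The `6φ5` sum itself is a specialisation of an identity for sums over the subsets `T` of a finite
set `S` of points `z_u` (`sum_subsetTerm`), with `t = |T|`, `e = 1 / b`, `d = 1 / c`:
`∑_T (-a q)^t ∏_{u ∈ T} z_u / (1 - a z_u q^t) ∏_{i < t} (e - q^i)(d - q^i)`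
`∏_{u ∈ T, v ∉ T} (z_u - q z_v) / (z_u - z_v)`
`∏_{v ∉ T} (1 - a q z_v e)(1 - a q z_v d) / (1 - a z_v q^(t+1)) = ∏_{u ∈ S} (1 - a q z_u e d)`.
Both sides are polynomials in `d` of degree at most `|S|`. They agree at `d = 1`, where only
`T = ∅` contributes, and at the `|S|` points `d = 1 / (a q z_w)`: there only the `T` containing `w`
contribute, and the sum over them is the same sum for `S \ {w}` with `a`, `e` replaced by `a q`,
`e / q` (`subsetTerm_insert`). Induction on `|S|` finishes the argument.

For the points `x_r q^i`, `i < N_r`, the cross product vanishes unless `T` is a union of initial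
segments `i < k_r` of the chains, and then it telescopes (`cross_box`). This is the sum over
`k ≤ N`. The resulting coefficients are those of the `6φ5` series because
`V(k) ∏_{r,s} (q^(-k_s) x_r/x_s)_{k_r}` equals `∏_{r,s} (q x_r/x_s)_{k_r}` up to a sign and a power
of `q` (`vandermonde_mul_lowerProd_self`).

The subset identity requires `a x_r q^i ≠ 1` for all `i` in a range that the hypotheses of the
`6φ5` sum do not cover. Its specialisation is therefore multiplied by `∏_r (a x_r)_{N_r + 1}`, and
the exceptional `a` are reached by continuity (`sum_clearedTerm`). This stronger form, without
division by `1 - a x_r`, is also needed for `inner_sum`, since `a x_r q^(|j| + j_r) = 1` may occur.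
-/

namespace AnSeries

/-! ### The sum over subsets -/

/-- `∏_{i < t} (e - q^i)`, which is `b^(-t) (b; q)_t` for `e = 1 / b`. -/
noncomputable def revPoch (q e : ℂ) (t : ℕ) : ℂ := ∏ i ∈ Finset.range t, (e - q ^ i)

theorem revPoch_succ (q e : ℂ) (t : ℕ) : revPoch q e (t + 1) = revPoch q e t * (e - q ^ t) := by
  rw [revPoch, Finset.prod_range_succ, revPoch]

theorem revPoch_succ' {q : ℂ} (hq : q ≠ 0) (e : ℂ) (t : ℕ) :
    revPoch q e (t + 1) = (e - 1) * (q ^ t * revPoch q (e / q) t) := by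
  rw [revPoch, Finset.prod_range_succ', revPoch, mul_comm, pow_zero]
  congr 1
  rw [← Finset.card_range t, ← Finset.prod_const, Finset.card_range, ← Finset.prod_mul_distrib]
  refine Finset.prod_congr rfl fun i _ => ?_
  field_simp
  ring

theorem revPoch_one {q : ℂ} {t : ℕ} (ht : t ≠ 0) : revPoch q 1 t = 0 :=
  Finset.prod_eq_zero (Finset.mem_range.2 (Nat.pos_of_ne_zero ht)) (by simp)

open Polynomial in
theorem natDegree_prod_linear_le {ι : Type*} (s : Finset ι) (f : ι → ℂ) :
    (∏ v ∈ s, (C (f v) * X + C 1)).natDegree ≤ s.card := by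
  refine (natDegree_prod_le _ _).trans ?_
  refine (Finset.sum_le_sum fun v _ => natDegree_linear_le).trans ?_
  simp

variable {ι : Type*} [DecidableEq ι]

/-- The summand of the subset identity `sum_subsetTerm`, indexed by `T ⊆ S`, for the points `z_u`.
The numbers `e` and `d` stand for the reciprocals of the parameters `b` and `c` of the `6φ5` sum, so
that the dependence on them is polynomial. -/
noncomputable def subsetTerm (q : ℂ) (z : ι → ℂ) (S : Finset ι) (a e d : ℂ) (T : Finset ι) : ℂ :=
  (-(a * q)) ^ T.card * (∏ u ∈ T, z u) * (revPoch q e T.card * revPoch q d T.card) *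
    (∏ u ∈ T, ∏ v ∈ S \ T, (z u - q * z v) / (z u - z v)) *
    (∏ v ∈ S \ T, (1 - a * q * z v * e) * (1 - a * q * z v * d) /
      (1 - a * z v * q ^ (T.card + 1))) *
    ∏ u ∈ T, (1 - a * z u * q ^ T.card)⁻¹

/-- At `d = 1 / (a q z_w)`, a summand whose index set contains `w` is `1 - e` times the summand
without the point `w`, with `a`, `e` replaced by `a q`, `e / q` and with the same `d`. -/
theorem subsetTerm_insert {q : ℂ} (hq : q ≠ 0) {z : ι → ℂ} {S T : Finset ι} {w : ι} {a : ℂ}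
    (e : ℂ) (ha : a ≠ 0) (hw : w ∉ S) (hzw : z w ≠ 0) (hzS : ∀ v ∈ S, z v ≠ z w)
    (hT : T ⊆ S) (hden : 1 - a * z w * q ^ (T.card + 1) ≠ 0) :
    subsetTerm q z (insert w S) a e (1 / (a * q * z w)) (insert w T) =
      (1 - e) * subsetTerm q z S (a * q) (e / q) (1 / (a * q * z w)) T := by
  have hwT : w ∉ T := fun h => hw (hT h)
  have hS : insert w S \ insert w T = S \ T := by
    ext v
    simp only [Finset.mem_sdiff, Finset.mem_insert]
    constructor
    · rintro ⟨h1, h2⟩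
      tauto
    · rintro ⟨h1, h2⟩
      refine ⟨Or.inr h1, ?_⟩
      rintro (rfl | h)
      · exact hw h1
      · exact h2 h
  unfold subsetTerm
  rw [hS, Finset.card_insert_of_notMem hwT, Finset.prod_insert hwT, Finset.prod_insert hwT,
    Finset.prod_insert hwT, revPoch_succ' hq e, revPoch_succ]
  have h1 : (∏ v ∈ S \ T, (z w - q * z v) / (z w - z v)) *
      (∏ v ∈ S \ T, (1 - a * q * z v * e) * (1 - a * q * z v * (1 / (a * q * z w))) /
        (1 - a * z v * q ^ (T.card + 1 + 1))) =
      ∏ v ∈ S \ T, (1 - a * q * q * z v * (e / q)) *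
        (1 - a * q * q * z v * (1 / (a * q * z w))) /
        (1 - a * q * z v * q ^ (T.card + 1)) := by
    rw [← Finset.prod_mul_distrib]
    refine Finset.prod_congr rfl fun v hv => ?_
    have hv' : z w - z v ≠ 0 := sub_ne_zero.2 (hzS v (Finset.mem_sdiff.1 hv).1).symm
    have e1 : a * z v * q ^ (T.card + 1 + 1) = a * q * z v * q ^ (T.card + 1) := by ring
    rw [e1, ← mul_div_assoc]
    congr 1
    field_simp
  have h2 : (∏ u ∈ T, (1 - a * q * z u * q ^ T.card)⁻¹) =
      ∏ u ∈ T, (1 - a * z u * q ^ (T.card + 1))⁻¹ :=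
    Finset.prod_congr rfl fun u _ => by
      rw [pow_succ]; congr 2; ring
  rw [← h1, h2]
  have h3 : (-(a * q)) ^ (T.card + 1) * z w * (q ^ T.card) *
      (1 / (a * q * z w) - q ^ T.card) * (1 - a * z w * q ^ (T.card + 1))⁻¹ * (e - 1)
      = (1 - e) * (-(a * q * q)) ^ T.card := by
    have e1 : (-(a * q * q)) ^ T.card = (-(a * q)) ^ T.card * q ^ T.card := by
      rw [← mul_pow]; ring
    have e2 : 1 / (a * q * z w) - q ^ T.card =
        (1 - a * z w * q ^ (T.card + 1)) / (a * q * z w) := by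
      rw [pow_succ]; field_simp
    rw [e1, e2, pow_succ]
    generalize 1 - a * z w * q ^ (T.card + 1) = D at *
    field_simp
    ring
  generalize (∏ v ∈ S \ T, (z w - q * z v) / (z w - z v)) = P1
  generalize (∏ v ∈ S \ T, (1 - a * q * z v * e) * (1 - a * q * z v * (1 / (a * q * z w))) /
        (1 - a * z v * q ^ (T.card + 1 + 1))) = P2
  linear_combination (P1 * P2 * (∏ u ∈ T, z u) * revPoch q (e / q) T.card *
    revPoch q (1 / (a * q * z w)) T.card *
    (∏ u ∈ T, ∏ v ∈ S \ T, (z u - q * z v) / (z u - z v)) *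
    ∏ u ∈ T, (1 - a * z u * q ^ (T.card + 1))⁻¹) * h3

open Polynomial in
/-- `subsetTerm` as a polynomial in the parameter `d`. -/
noncomputable def subsetPoly (q : ℂ) (z : ι → ℂ) (S : Finset ι) (a e : ℂ) (T : Finset ι) : ℂ[X] :=
  C ((-(a * q)) ^ T.card * (∏ u ∈ T, z u) * revPoch q e T.card *
    (∏ u ∈ T, ∏ v ∈ S \ T, (z u - q * z v) / (z u - z v)) *
    (∏ v ∈ S \ T, (1 - a * q * z v * e) / (1 - a * z v * q ^ (T.card + 1))) *
    ∏ u ∈ T, (1 - a * z u * q ^ T.card)⁻¹) *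
    ((∏ i ∈ Finset.range T.card, (X - C (q ^ i))) *
      ∏ v ∈ S \ T, (C (-(a * q * z v)) * X + C 1))

open Polynomial in
theorem eval_subsetPoly (q : ℂ) (z : ι → ℂ) (S : Finset ι) (a e d : ℂ) (T : Finset ι) :
    (subsetPoly q z S a e T).eval d = subsetTerm q z S a e d T := by
  have h : (∏ v ∈ S \ T, (1 - a * q * z v * e) * (1 - a * q * z v * d) /
      (1 - a * z v * q ^ (T.card + 1))) =
      (∏ v ∈ S \ T, (1 - a * q * z v * e) / (1 - a * z v * q ^ (T.card + 1))) *
      ∏ v ∈ S \ T, (-(a * q * z v) * d + 1) := by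
    rw [← Finset.prod_mul_distrib]
    exact Finset.prod_congr rfl fun v _ => by ring
  rw [subsetTerm, h]
  simp only [subsetPoly, eval_mul, eval_C, eval_prod, eval_sub, eval_X, eval_add, revPoch]
  ring

open Polynomial in
theorem natDegree_subsetPoly_le (q : ℂ) (z : ι → ℂ) {S T : Finset ι} (a e : ℂ) (hT : T ⊆ S) :
    (subsetPoly q z S a e T).natDegree ≤ S.card := by
  refine (natDegree_C_mul_le _ _).trans (natDegree_mul_le.trans ?_)
  rw [natDegree_prod_of_monic _ _ fun i _ => monic_X_sub_C _]
  simp only [natDegree_X_sub_C, Finset.sum_const, Finset.card_range, smul_eq_mul, mul_one]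
  have := natDegree_prod_linear_le (S \ T) fun v => -(a * q * z v)
  have h2 := Finset.card_sdiff_add_card_eq_card hT
  omega

open Polynomial in
/-- The sum over subsets, proved by comparing two polynomials in `d` of degree at most `|S|` at
`|S| + 1` points and by induction on `m = |S|`. -/
theorem sum_subsetTerm {q : ℂ} (hq : q ≠ 0) {z : ι → ℂ} (hz : ∀ u, z u ≠ 0) (m : ℕ) :
    ∀ (S : Finset ι) (a e d : ℂ), S.card = m → a ≠ 0 → Set.InjOn z S →
      (∀ u ∈ S, ∀ i ≤ m + 1, 1 - a * z u * q ^ i ≠ 0) →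
      ∑ T ∈ S.powerset, subsetTerm q z S a e d T = ∏ u ∈ S, (1 - a * q * z u * e * d) := by
  induction m with
  | zero =>
    intro S a e d hS _ _ _
    rw [Finset.card_eq_zero.1 hS]
    simp [subsetTerm, revPoch]
  | succ m ih =>
    intro S a e d hS ha hinj hden
    -- these points are distinct because `z` is injective on `S` and `a q z_u ≠ 1`
    set nodes : Finset ℂ := insert 1 (S.image fun u => 1 / (a * q * z u)) with hnodes
    have hcard : nodes.card = m + 2 := by
      rw [hnodes, Finset.card_insert_of_notMem, Finset.card_image_of_injOn, hS]
      · intro u hu v hv huv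
        refine hinj hu hv ?_
        have h1 := hz u
        have h2 := hz v
        simp only at huv
        field_simp at huv
        exact huv.symm
      · intro h
        obtain ⟨u, hu, h⟩ := Finset.mem_image.1 h
        refine hden u hu 1 (by omega) ?_
        have h1 := hz u
        field_simp at h
        rw [pow_one]
        linear_combination h
    have key : (∑ T ∈ S.powerset, subsetPoly q z S a e T) =
        ∏ u ∈ S, (C (-(a * q * z u * e)) * X + C 1) := by
      refine eq_of_natDegree_lt_card_of_eval_eq' _ _ nodes ?_ ?_
      · intro y hy
        simp only [eval_finsetSum, eval_subsetPoly, eval_prod, eval_add, eval_mul, eval_C, eval_X]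
        rcases Finset.mem_insert.1 hy with rfl | hy
        · -- at `d = 1` only the empty set contributes
          rw [Finset.sum_eq_single ∅]
          · simp only [subsetTerm, revPoch, Finset.card_empty, Finset.sdiff_empty]
            simp only [pow_zero, Finset.prod_empty, one_mul, mul_one, Finset.range_zero]
            refine Finset.prod_congr rfl fun v hv => ?_
            have := hden v hv 1 (by omega)
            rw [zero_add, div_eq_iff this]
            ring
          · intro T _ hT
            have : T.card ≠ 0 := by simpa using hT
            simp [subsetTerm, revPoch_one this]
          · simp
        · obtain ⟨w, hw, rfl⟩ := Finset.mem_image.1 hy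
          have hwS : w ∉ S.erase w := Finset.notMem_erase w S
          have hSw : insert w (S.erase w) = S := Finset.insert_erase hw
          have hzw := hz w
          rw [← hSw, Finset.sum_powerset_insert hwS, Finset.sum_eq_zero, zero_add]
          · rw [Finset.prod_insert hwS]
            have hI := ih (S.erase w) (a * q) (e / q) (1 / (a * q * z w))
              (by rw [Finset.card_erase_of_mem hw, hS]; rfl) (mul_ne_zero ha hq)
              (hinj.mono (by simp))
              (fun u hu i hi => by
                have := hden u (Finset.mem_of_mem_erase hu) (i + 1) (by omega)
                rw [pow_succ] at this
                convert this using 2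
                ring)
            have hs : ∀ T ∈ (S.erase w).powerset,
                subsetTerm q z (insert w (S.erase w)) a e (1 / (a * q * z w)) (insert w T) =
                (1 - e) * subsetTerm q z (S.erase w) (a * q) (e / q) (1 / (a * q * z w)) T := by
              intro T hT
              have hT := Finset.mem_powerset.1 hT
              refine subsetTerm_insert hq e ha hwS hzw ?_ hT ?_
              · intro v hv h
                exact Finset.ne_of_mem_erase hv (hinj (Finset.mem_of_mem_erase hv) hw h)
              · refine hden w hw _ ?_
                have := Finset.card_le_card hT
                rw [Finset.card_erase_of_mem hw] at this
                omega
            rw [Finset.sum_congr rfl hs, ← Finset.mul_sum, hI]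
            congr 1
            · field_simp
              ring
            · refine Finset.prod_congr rfl fun u _ => ?_
              field_simp
              ring
          · intro T hT
            have hwT : w ∈ insert w (S.erase w) \ T := by
              refine Finset.mem_sdiff.2 ⟨Finset.mem_insert_self _ _, fun h => ?_⟩
              exact hwS (Finset.mem_powerset.1 hT h)
            rw [subsetTerm]
            have h0 : (∏ v ∈ insert w (S.erase w) \ T, (1 - a * q * z v * e) *
                (1 - a * q * z v * (1 / (a * q * z w))) /
                (1 - a * z v * q ^ (T.card + 1))) = 0 := by
              refine Finset.prod_eq_zero hwT ?_
              have : 1 - a * q * z w * (1 / (a * q * z w)) = 0 := by field_simp; ring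
              rw [this]; simp
            rw [h0]; simp
      · rw [hcard]
        refine max_lt ?_ ?_
        · refine lt_of_le_of_lt (natDegree_sum_le_of_forall_le _ _ fun T hT =>
            natDegree_subsetPoly_le q z a e (Finset.mem_powerset.1 hT)) ?_
          omega
        · refine lt_of_le_of_lt (natDegree_prod_linear_le S fun u => -(a * q * z u * e)) ?_
          omega
    have := congrArg (eval d) key
    simp only [eval_finsetSum, eval_subsetPoly, eval_prod, eval_add, eval_mul, eval_C, eval_X]
      at this
    rw [this]
    exact Finset.prod_congr rfl fun u _ => by ring

/-! ### Shifted factorials and boxes of nodes -/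

theorem qPoch_one (q c : ℂ) : qPoch q c 1 = 1 - c := by simp [qPoch]

theorem qPoch_add (q c : ℂ) (k l : ℕ) :
    qPoch q c (k + l) = qPoch q c k * qPoch q (c * q ^ k) l := by
  rw [qPoch, Finset.prod_range_add, qPoch, qPoch]
  congr 1
  exact Finset.prod_congr rfl fun i _ => by rw [pow_add]; ring

theorem qPoch_succ' (q c : ℂ) (k : ℕ) :
    qPoch q c (k + 1) = (1 - c) * qPoch q (c * q) k := by
  rw [add_comm, qPoch_add, qPoch_one, pow_one]

theorem qPoch_ne_zero_iff {q c : ℂ} {k : ℕ} :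
    qPoch q c k ≠ 0 ↔ ∀ i < k, 1 - c * q ^ i ≠ 0 := by
  simp [qPoch, Finset.prod_ne_zero_iff]

theorem qPoch_ne_zero_of_le {q c : ℂ} {k l : ℕ} (hkl : k ≤ l) (h : qPoch q c l ≠ 0) :
    qPoch q c k ≠ 0 :=
  qPoch_ne_zero_iff.2 fun i hi => qPoch_ne_zero_iff.1 h i (hi.trans_le hkl)

/-- Reversal of the order of the factors. -/
theorem qPoch_reverse {q c : ℂ} (hq : q ≠ 0) (hc : c ≠ 0) (l : ℕ) :
    qPoch q c l = (∏ i ∈ Finset.range l, -(c * q ^ i)) * qPoch q (q ^ (1 - (l : ℤ)) / c) l := by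
  have h : qPoch q (q ^ (1 - (l : ℤ)) / c) l =
      ∏ i ∈ Finset.range l, (1 - 1 / (c * q ^ i)) := by
    rw [qPoch, ← Finset.prod_range_reflect]
    refine Finset.prod_congr rfl fun i hi => ?_
    have hi := Finset.mem_range.1 hi
    have e : q ^ (1 - (l : ℤ)) * q ^ (l - 1 - i) * q ^ i = 1 := by
      rw [← zpow_natCast, ← zpow_natCast, ← zpow_add₀ hq, ← zpow_add₀ hq]
      convert zpow_zero q
      omega
    rw [sub_right_inj, div_mul_eq_mul_div, div_eq_div_iff hc (by positivity)]
    linear_combination c * e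
  rw [h, ← Finset.prod_mul_distrib, qPoch]
  refine Finset.prod_congr rfl fun i _ => ?_
  field_simp
  ring

theorem revPoch_inv {b : ℂ} (hb : b ≠ 0) (q : ℂ) (t : ℕ) :
    revPoch q (1 / b) t = qPoch q b t / b ^ t := by
  rw [eq_div_iff (pow_ne_zero _ hb), revPoch, qPoch]
  nth_rw 2 [← Finset.card_range t]
  rw [← Finset.prod_const, ← Finset.prod_mul_distrib]
  exact Finset.prod_congr rfl fun i _ => by field_simp

theorem prod_Ico_eq_qPoch (q c : ℂ) (k N : ℕ) :
    ∏ i ∈ Finset.Ico k N, (1 - c * q ^ i) = qPoch q (c * q ^ k) (N - k) := by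
  rw [Finset.prod_Ico_eq_prod_range, qPoch]
  exact Finset.prod_congr rfl fun i _ => by rw [pow_add]; ring

variable {n : ℕ}

theorem size_le_size {k N : Fin n → ℕ} (h : k ≤ N) : size k ≤ size N :=
  Finset.sum_le_sum fun r _ => h r

theorem le_size (k : Fin n → ℕ) (r : Fin n) : k r ≤ size k :=
  Finset.single_le_sum (fun _ _ => Nat.zero_le _) (Finset.mem_univ r)

theorem size_add (j k : Fin n → ℕ) : size (j + k) = size j + size k := by
  simp [size, Finset.sum_add_distrib]

/-- `∏_r (-x_r)^(k_r) q^(k_r (k_r - 1) / 2)`, the product of `-x_r q^i` over `i < k_r`. -/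
noncomputable def nodeProd (q : ℂ) (x : Fin n → ℂ) (k : Fin n → ℕ) : ℂ :=
  ∏ r, ∏ i ∈ Finset.range (k r), -(x r * q ^ i)

/-- The index set of the nodes `x_r q^i` with `i < k_r`. -/
def box (k : Fin n → ℕ) : Finset (Σ _ : Fin n, ℕ) :=
  Finset.univ.sigma fun r => Finset.range (k r)

/-- The node `x_r q^i`. -/
def node (q : ℂ) (x : Fin n → ℂ) (u : Σ _ : Fin n, ℕ) : ℂ := x u.1 * q ^ u.2

theorem mem_box {k : Fin n → ℕ} {u : Σ _ : Fin n, ℕ} : u ∈ box k ↔ u.2 < k u.1 := by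
  simp [box]

theorem card_box (k : Fin n → ℕ) : (box k).card = size k := by
  simp [box, size]

theorem box_subset_box {k N : Fin n → ℕ} (h : k ≤ N) : box k ⊆ box N := fun u hu =>
  mem_box.2 ((mem_box.1 hu).trans_le (h u.1))

theorem box_injective : Function.Injective (box (n := n)) := by
  intro k l h
  funext r
  refine eq_of_forall_lt_iff fun i => ?_
  have := congrArg (fun S => (⟨r, i⟩ : Σ _ : Fin n, ℕ) ∈ S) h
  simpa [mem_box] using this

theorem box_sdiff (k N : Fin n → ℕ) :
    box N \ box k = Finset.univ.sigma fun r => Finset.Ico (k r) (N r) := by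
  ext u
  simp [box, and_comm]

/-- A subset of `box N` that contains `(r, i)` whenever it contains `(r, i + 1)` is a box. -/
theorem exists_eq_box {N : Fin n → ℕ} {T : Finset (Σ _ : Fin n, ℕ)} (hT : T ⊆ box N)
    (h : ∀ r i, (⟨r, i + 1⟩ : Σ _ : Fin n, ℕ) ∈ T → (⟨r, i⟩ : Σ _ : Fin n, ℕ) ∈ T) :
    ∃ k ≤ N, box k = T := by
  classical
  have hex : ∀ r, ∃ i, (⟨r, i⟩ : Σ _ : Fin n, ℕ) ∉ T := fun r =>
    ⟨N r, fun h => absurd (mem_box.1 (hT h)) (lt_irrefl _)⟩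
  refine ⟨fun r => Nat.find (hex r), fun r => ?_, ?_⟩
  · exact Nat.find_min' _ fun h => absurd (mem_box.1 (hT h)) (lt_irrefl _)
  · ext ⟨r, i⟩
    rw [mem_box]
    constructor
    · intro hi
      exact not_not.1 (Nat.find_min (hex r) hi)
    · intro hi
      by_contra hlt
      rw [not_lt] at hlt
      have : ∀ m, (⟨r, Nat.find (hex r) + m⟩ : Σ _ : Fin n, ℕ) ∉ T := by
        intro m
        induction m with
        | zero => exact Nat.find_spec (hex r)
        | succ m ih => exact fun hm => ih (h r _ hm)
      have h2 := this (i - Nat.find (hex r))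
      rw [Nat.add_sub_cancel' hlt] at h2
      exact h2 hi

/-- Distinctness of the chains `x_r, x_r q, …, x_r q^(N_r)` for different `r`. -/
def Separated (q : ℂ) (x : Fin n → ℂ) (N : Fin n → ℕ) : Prop :=
  ∀ r s, r ≠ s → ∀ i ≤ N r, ∀ j ≤ N s, x r * q ^ i ≠ x s * q ^ j

theorem pow_injective_of_norm_lt_one {q : ℂ} (hq0 : q ≠ 0) (hq1 : ‖q‖ < 1) :
    Function.Injective fun i : ℕ => q ^ i := by
  intro i j h
  have h2 : ‖q‖ ^ i = ‖q‖ ^ j := by simpa using congrArg norm h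
  exact (pow_right_injective₀ (norm_pos_iff.2 hq0) hq1.ne) h2

theorem node_injOn {q : ℂ} (hq0 : q ≠ 0) (hq1 : ‖q‖ < 1) {x : Fin n → ℂ} (hx0 : ∀ r, x r ≠ 0)
    {N : Fin n → ℕ} (hx : Separated q x N) : Set.InjOn (node q x) (box N) := by
  rintro ⟨r, i⟩ hu ⟨s, j⟩ hv h
  have hi := (mem_box.1 hu).le
  have hj := (mem_box.1 hv).le
  simp only [node] at h hi hj
  obtain rfl | hrs := eq_or_ne r s
  · have := pow_injective_of_norm_lt_one hq0 hq1 (mul_left_cancel₀ (hx0 r) h)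
    rw [this]
  · exact absurd h (hx r s hrs i hi j hj)

theorem mul_q_pow_ne {q : ℂ} (hq0 : q ≠ 0) (hq1 : ‖q‖ < 1) {x : Fin n → ℂ} (hx0 : ∀ r, x r ≠ 0)
    {N : Fin n → ℕ} (hx : Separated q x N) (r s : Fin n) {i j : ℕ} (hi : i ≤ N r) (hj : j ≤ N s)
    (hij : i ≠ j) : x r * q ^ i ≠ x s * q ^ j := by
  obtain rfl | hrs := eq_or_ne r s
  · exact fun h => hij (pow_injective_of_norm_lt_one hq0 hq1 (mul_left_cancel₀ (hx0 r) h))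
  · exact hx r s hrs i hi j hj

theorem prod_Ico_div_telescope {f : ℕ → ℂ} {k N : ℕ} (hkN : k ≤ N)
    (hf : ∀ i, k ≤ i → i ≤ N → f i ≠ 0) :
    ∏ i ∈ Finset.Ico k N, f (i + 1) / f i = f N / f k := by
  induction N, hkN using Nat.le_induction with
  | base => simp [hf k le_rfl le_rfl]
  | succ m hkm ih =>
    rw [Finset.prod_Ico_succ_top hkm, ih fun i h1 h2 => hf i h1 (h2.trans (Nat.le_succ m))]
    have := hf m hkm (Nat.le_succ m)
    field_simp

theorem qPoch_neg_zpow_mul {q : ℂ} (hq : q ≠ 0) {y : ℂ} (hy : y ≠ 0) (w : ℂ) (N k : ℕ) :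
    ∏ i ∈ Finset.range k, (w * q ^ i - y * q ^ N) =
      (-(y * q ^ N)) ^ k * qPoch q (q ^ (-(N : ℤ)) * (w / y)) k := by
  nth_rw 2 [← Finset.card_range k]
  rw [← Finset.prod_const, qPoch, ← Finset.prod_mul_distrib]
  refine Finset.prod_congr rfl fun i _ => ?_
  rw [zpow_neg, zpow_natCast]
  field_simp
  ring

/-- For a box, the cross product over the pairs `u ∈ T`, `v ∉ T` telescopes. -/
theorem cross_box {q : ℂ} (hq0 : q ≠ 0) (hq1 : ‖q‖ < 1) {x : Fin n → ℂ} (hx0 : ∀ r, x r ≠ 0)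
    {k N : Fin n → ℕ} (hx : Separated q x N) (hk : k ≤ N) :
    ∏ u ∈ box k, ∏ v ∈ box N \ box k,
        (node q x u - q * node q x v) / (node q x u - node q x v) =
      q ^ (size k * (size N - size k)) * (lowerProd q x N k / lowerProd q x k k) := by
  have hsub : size N - size k = ∑ s, (N s - k s) := by
    have : size N = size k + ∑ s, (N s - k s) := by
      rw [size, size, ← Finset.sum_add_distrib]
      exact Finset.sum_congr rfl fun s _ => (Nat.add_sub_cancel' (hk s)).symm
    omega
  have hq : q ^ (size k * (size N - size k)) = ∏ r, ∏ s, (q ^ (N s - k s)) ^ k r := by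
    simp_rw [Finset.prod_pow, Finset.prod_pow_eq_pow_sum]
    rw [← hsub, ← size, ← pow_mul, mul_comm]
  rw [box_sdiff, box, Finset.prod_sigma, hq, lowerProd, lowerProd, ← Finset.prod_div_distrib,
    ← Finset.prod_mul_distrib]
  refine Finset.prod_congr rfl fun r _ => ?_
  rw [← Finset.prod_div_distrib, ← Finset.prod_mul_distrib]
  simp_rw [Finset.prod_sigma]
  rw [Finset.prod_comm]
  refine Finset.prod_congr rfl fun s _ => ?_
  have h1 : ∀ i ∈ Finset.range (k r), ∏ j ∈ Finset.Ico (k s) (N s),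
      (node q x ⟨r, i⟩ - q * node q x ⟨s, j⟩) / (node q x ⟨r, i⟩ - node q x ⟨s, j⟩) =
      (x r * q ^ i - x s * q ^ N s) / (x r * q ^ i - x s * q ^ k s) := by
    intro i hi
    have hi := Finset.mem_range.1 hi
    rw [← prod_Ico_div_telescope (f := fun j => x r * q ^ i - x s * q ^ j) (hk s)]
    · refine Finset.prod_congr rfl fun j _ => ?_
      simp only [node, pow_succ]
      congr 1
      ring
    · intro j h1 h2
      rw [sub_ne_zero]
      obtain rfl | hrs := eq_or_ne r s
      · exact mul_q_pow_ne hq0 hq1 hx0 hx r r (hi.le.trans (hk r)) h2 (by omega)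
      · exact hx r s hrs i (hi.le.trans (hk r)) j h2
  rw [Finset.prod_congr rfl h1, Finset.prod_div_distrib, qPoch_neg_zpow_mul hq0 (hx0 s),
    qPoch_neg_zpow_mul hq0 (hx0 s), mul_div_mul_comm]
  congr 1
  rw [← div_pow]
  congr 1
  have := hx0 s
  rw [← Nat.sub_add_cancel (hk s), pow_add, Nat.add_sub_cancel]
  field_simp

/-- A summand of the subset identity vanishes unless its index set is a box. -/
theorem subsetTerm_eq_zero {q : ℂ} {x : Fin n → ℂ} {N : Fin n → ℕ} (a e d : ℂ)
    {T : Finset (Σ _ : Fin n, ℕ)} (hT : T ⊆ box N) (h : ∀ k ≤ N, box k ≠ T) :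
    subsetTerm q (node q x) (box N) a e d T = 0 := by
  have : ¬ ∀ r i, (⟨r, i + 1⟩ : Σ _ : Fin n, ℕ) ∈ T → (⟨r, i⟩ : Σ _ : Fin n, ℕ) ∈ T := by
    intro h2
    obtain ⟨k, hk, hkT⟩ := exists_eq_box hT h2
    exact h k hk hkT
  push Not at this
  obtain ⟨r, i, h1, h2⟩ := this
  have hv : (⟨r, i⟩ : Σ _ : Fin n, ℕ) ∈ box N \ T := by
    refine Finset.mem_sdiff.2 ⟨mem_box.2 ?_, h2⟩
    exact lt_trans (Nat.lt_succ_self i) (mem_box.1 (hT h1))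
  have : ∏ u ∈ T, ∏ v ∈ box N \ T,
      (node q x u - q * node q x v) / (node q x u - node q x v) = 0 := by
    refine Finset.prod_eq_zero h1 (Finset.prod_eq_zero hv ?_)
    simp only [node, pow_succ]
    ring
  rw [subsetTerm, this]
  simp

theorem sum_powerset_box {q : ℂ} {x : Fin n → ℂ} {N : Fin n → ℕ} (a e d : ℂ) :
    ∑ T ∈ (box N).powerset, subsetTerm q (node q x) (box N) a e d T =
      ∑ k ∈ Finset.Iic N, subsetTerm q (node q x) (box N) a e d (box k) := by
  rw [← Finset.sum_image (s := Finset.Iic N) (g := box)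
    (f := fun T => subsetTerm q (node q x) (box N) a e d T) fun k _ l _ h => box_injective h]
  symm
  refine Finset.sum_subset ?_ ?_
  · intro T hT
    obtain ⟨k, hk, rfl⟩ := Finset.mem_image.1 hT
    exact Finset.mem_powerset.2 (box_subset_box (Finset.mem_Iic.1 hk))
  · intro T hT hT2
    refine subsetTerm_eq_zero a e d (Finset.mem_powerset.1 hT) fun k hk h => hT2 ?_
    exact Finset.mem_image.2 ⟨k, Finset.mem_Iic.2 hk, h⟩

/-! ### Milne's `6φ5` sum -/

open scoped Topology
/-- The coefficient of the `6φ5` sum: the multiple `q`-binomial coefficient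
`∏_{r,s} (q^(-N_s) x_r/x_s)_{k_r} / (q^(-k_s) x_r/x_s)_{k_r}`, which behaves well under shifts of
`k` and needs no Vandermonde factor, times `nodeProd` and a power of `q`. The subtraction of natural
numbers in the exponent is harmless for `k ≤ N`. -/
noncomputable def chainCoeff (q : ℂ) (x : Fin n → ℂ) (N k : Fin n → ℕ) : ℂ :=
  lowerProd q x N k / lowerProd q x k k * q ^ (size k * (size N - size k)) * nodeProd q x k

/-- The summand of the `6φ5` sum multiplied by
`∏_r (1 - a x_r) (a q x_r / b)_{N_r} (a q x_r / c)_{N_r}`, with `e = 1 / b` and `d = 1 / c`. -/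
noncomputable def clearedTerm (q : ℂ) (x : Fin n → ℂ) (N : Fin n → ℕ) (e d : ℂ) (k : Fin n → ℕ)
    (a : ℂ) : ℂ :=
  chainCoeff q x N k * (a * q) ^ size k * (revPoch q e (size k) * revPoch q d (size k)) *
    ∏ r, qPoch q (a * q * e * x r * q ^ k r) (N r - k r) *
      qPoch q (a * q * d * x r * q ^ k r) (N r - k r) *
      ((1 - a * x r * q ^ (k r + size k)) * qPoch q (a * x r) (size k) /
        qPoch q (a * x r * q ^ (1 + N r)) (size k))

theorem prod_node_box (q : ℂ) (x : Fin n → ℂ) (k : Fin n → ℕ) (a : ℂ) :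
    (-a) ^ (box k).card * ∏ u ∈ box k, node q x u = a ^ size k * nodeProd q x k := by
  have h : (-a) ^ (box k).card * ∏ u ∈ box k, node q x u = ∏ u ∈ box k, a * -node q x u := by
    rw [← Finset.prod_const, ← Finset.prod_mul_distrib]
    exact Finset.prod_congr rfl fun u _ => by ring
  rw [h, Finset.prod_mul_distrib, Finset.prod_const, card_box, box, Finset.prod_sigma]
  rfl

/-- The summand of the subset identity at a box. The factors with `1 - a x_r q^i` combine because
`(a x_r)_{N_r + 1 + |k|}` can be split both after `N_r + 1` factors and after `|k|` factors. -/
theorem subsetTerm_box {q : ℂ} (hq0 : q ≠ 0) (hq1 : ‖q‖ < 1) {x : Fin n → ℂ}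
    (hx0 : ∀ r, x r ≠ 0) {k N : Fin n → ℕ} (hx : Separated q x N) (hk : k ≤ N) (a e d : ℂ)
    (ha : ∀ r, qPoch q (a * x r) (N r + 1 + size k) ≠ 0) :
    subsetTerm q (node q x) (box N) a e d (box k) * ∏ r, qPoch q (a * x r) (N r + 1) =
      clearedTerm q x N e d k a := by
  have hcross := cross_box hq0 hq1 hx0 hx hk
  have h1 : (∏ v ∈ box N \ box k, (1 - a * q * node q x v * e) * (1 - a * q * node q x v * d) /
      (1 - a * node q x v * q ^ (size k + 1))) = ∏ r,
      qPoch q (a * q * e * x r * q ^ k r) (N r - k r) *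
        qPoch q (a * q * d * x r * q ^ k r) (N r - k r) /
        qPoch q (a * x r * q ^ (size k + 1) * q ^ k r) (N r - k r) := by
    rw [box_sdiff, Finset.prod_sigma]
    refine Finset.prod_congr rfl fun r _ => ?_
    rw [← prod_Ico_eq_qPoch, ← prod_Ico_eq_qPoch, ← prod_Ico_eq_qPoch,
      ← Finset.prod_mul_distrib, ← Finset.prod_div_distrib]
    refine Finset.prod_congr rfl fun i _ => ?_
    simp only [node]
    congr 1
    · congr 1 <;> ring
    · ring
  have h2 : (∏ u ∈ box k, (1 - a * node q x u * q ^ size k)⁻¹) =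
      ∏ r, (qPoch q (a * x r * q ^ size k) (k r))⁻¹ := by
    rw [box, Finset.prod_sigma]
    refine Finset.prod_congr rfl fun r _ => ?_
    rw [qPoch, Finset.prod_inv_distrib]
    congr 1
    refine Finset.prod_congr rfl fun i _ => ?_
    simp only [node]
    ring
  have hmain : (∏ r, qPoch q (a * q * e * x r * q ^ k r) (N r - k r) *
        qPoch q (a * q * d * x r * q ^ k r) (N r - k r) /
        qPoch q (a * x r * q ^ (size k + 1) * q ^ k r) (N r - k r)) *
      (∏ r, (qPoch q (a * x r * q ^ size k) (k r))⁻¹) * ∏ r, qPoch q (a * x r) (N r + 1) =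
      ∏ r, qPoch q (a * q * e * x r * q ^ k r) (N r - k r) *
      qPoch q (a * q * d * x r * q ^ k r) (N r - k r) *
      ((1 - a * x r * q ^ (k r + size k)) * qPoch q (a * x r) (size k) /
        qPoch q (a * x r * q ^ (1 + N r)) (size k)) := by
    rw [← Finset.prod_mul_distrib, ← Finset.prod_mul_distrib]
    refine Finset.prod_congr rfl fun r _ => ?_
    have e1 := qPoch_add q (a * x r) (N r + 1) (size k)
    have e2 : qPoch q (a * x r) (N r + 1 + size k) = qPoch q (a * x r) (size k) *
        (qPoch q (a * x r * q ^ size k) (k r) * ((1 - a * x r * q ^ (k r + size k)) *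
          qPoch q (a * x r * q ^ (size k + 1) * q ^ k r) (N r - k r))) := by
      have : N r + 1 + size k = size k + (k r + (1 + (N r - k r))) := by
        have : k r ≤ N r := hk r
        omega
      rw [this, qPoch_add, qPoch_add, qPoch_add, qPoch_one]
      congr 3
      · rw [pow_add]; ring
      · congr 1; ring
    rw [add_comm 1 (N r)]
    have hne := ha r
    have hne2 := hne
    rw [e2] at hne2
    have h3 := e1.symm.trans e2
    rw [e1] at hne
    obtain ⟨g1, g2⟩ := mul_ne_zero_iff.1 hne
    obtain ⟨_, g3⟩ := mul_ne_zero_iff.1 hne2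
    obtain ⟨g4, g5⟩ := mul_ne_zero_iff.1 g3
    obtain ⟨_, g6⟩ := mul_ne_zero_iff.1 g5
    generalize qPoch q (a * x r * q ^ (size k + 1) * q ^ k r) (N r - k r) = D at *
    generalize qPoch q (a * x r * q ^ size k) (k r) = E at *
    generalize qPoch q (a * x r * q ^ (N r + 1)) (size k) = F at *
    rw [div_mul_eq_mul_div, mul_div_assoc, mul_assoc]
    congr 1
    field_simp
    linear_combination h3
  rw [subsetTerm, card_box, ← card_box, prod_node_box, hcross, card_box, h1, h2, clearedTerm,
    ← hmain, chainCoeff]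
  ring

theorem sum_clearedTerm_generic {q : ℂ} (hq0 : q ≠ 0) (hq1 : ‖q‖ < 1) {x : Fin n → ℂ}
    (hx0 : ∀ r, x r ≠ 0) {N : Fin n → ℕ} (hx : Separated q x N) {a : ℂ} (e d : ℂ) (ha0 : a ≠ 0)
    (ha : ∀ r, qPoch q (a * x r) (2 * size N + 2) ≠ 0) :
    ∑ k ∈ Finset.Iic N, clearedTerm q x N e d k a =
      ∏ r, qPoch q (a * q * e * d * x r) (N r) * qPoch q (a * x r) (N r + 1) := by
  have h := sum_subsetTerm hq0 (z := node q x)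
    (fun u => mul_ne_zero (hx0 u.1) (pow_ne_zero _ hq0)) _ (box N) a e d rfl ha0
    (node_injOn hq0 hq1 hx0 hx) (by
      intro u hu i hi
      have h1 := mem_box.1 hu
      have h2 := le_size N u.1
      rw [card_box] at hi
      have := qPoch_ne_zero_iff.1 (ha u.1) (u.2 + i) (by omega)
      rw [node]
      rw [pow_add] at this
      convert this using 2
      ring)
  rw [sum_powerset_box] at h
  rw [Finset.prod_mul_distrib]
  have h3 : ∏ u ∈ box N, (1 - a * q * node q x u * e * d) =
      ∏ r, qPoch q (a * q * e * d * x r) (N r) := by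
    rw [box, Finset.prod_sigma]
    refine Finset.prod_congr rfl fun r _ => ?_
    rw [qPoch]
    refine Finset.prod_congr rfl fun i _ => ?_
    rw [node]; ring
  rw [← h3, ← h, Finset.sum_mul]
  refine Finset.sum_congr rfl fun k hk => ?_
  have hk := Finset.mem_Iic.1 hk
  refine (subsetTerm_box hq0 hq1 hx0 hx hk a e d fun r => ?_).symm
  refine qPoch_ne_zero_of_le ?_ (ha r)
  have := size_le_size hk
  have := le_size N r
  omega

theorem continuous_qPoch (q : ℂ) (k : ℕ) : Continuous fun c => qPoch q c k := by
  unfold qPoch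
  fun_prop

theorem continuousAt_clearedTerm {q : ℂ} {x : Fin n → ℂ} {N k : Fin n → ℕ} (hk : k ≤ N) {a : ℂ}
    (e d : ℂ) (ha : ∀ r, qPoch q (a * x r * q ^ (1 + N r)) (size N) ≠ 0) :
    ContinuousAt (clearedTerm q x N e d k) a := by
  have h1 : ∀ (m : ℕ) (f : ℂ → ℂ), Continuous f → ContinuousAt (fun a => qPoch q (f a) m) a :=
    fun m f hf => ((continuous_qPoch q m).comp hf).continuousAt
  unfold clearedTerm
  refine ContinuousAt.mul (by fun_prop) ?_
  refine tendsto_finsetProd _ fun r _ => ?_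
  refine ((h1 _ _ (by fun_prop)).mul (h1 _ _ (by fun_prop))).mul
    (ContinuousAt.div (ContinuousAt.mul (by fun_prop) (h1 _ _ (by fun_prop)))
      (h1 _ _ (by fun_prop)) ?_)
  exact qPoch_ne_zero_of_le (size_le_size hk) (ha r)

/-- `(c y)_k` vanishes for finitely many `c` only. -/
theorem eventually_qPoch_ne_zero {q : ℂ} (hq : q ≠ 0) {y : ℂ} (hy : y ≠ 0) (k : ℕ) (a : ℂ) :
    ∀ᶠ c in 𝓝[≠] a, qPoch q (c * y) k ≠ 0 := by
  simp_rw [qPoch_ne_zero_iff]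
  have : ∀ᶠ c in 𝓝[≠] a, ∀ i ∈ Finset.range k, 1 - c * y * q ^ i ≠ 0 := by
    rw [Filter.eventually_all_finset]
    intro i _
    have hfin : ({1 / (y * q ^ i)} : Set ℂ).Finite := Set.finite_singleton _
    have := hfin.isClosed.isOpen_compl
    by_cases hai : a = 1 / (y * q ^ i)
    · filter_upwards [self_mem_nhdsWithin] with c hc h
      refine hc ?_
      rw [Set.mem_singleton_iff, hai, eq_div_iff (by positivity)]
      linear_combination -h
    · filter_upwards [nhdsWithin_le_nhds (this.mem_nhds hai)] with c hc h
      refine hc ?_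
      rw [Set.mem_singleton_iff, eq_div_iff (by positivity)]
      linear_combination -h
  filter_upwards [this] with c hc i hi
  exact hc i (Finset.mem_range.2 hi)

/-- The denominator-cleared `6φ5` sum. Parameters `a` at which `a x_r q^i = 1` for some
`i ≤ N_r` are reached by continuity. -/
theorem sum_clearedTerm {q : ℂ} (hq0 : q ≠ 0) (hq1 : ‖q‖ < 1) {x : Fin n → ℂ}
    (hx0 : ∀ r, x r ≠ 0) {N : Fin n → ℕ} (hx : Separated q x N) {a : ℂ} (e d : ℂ)
    (ha : ∀ r, qPoch q (a * x r * q ^ (1 + N r)) (size N) ≠ 0) :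
    ∑ k ∈ Finset.Iic N, clearedTerm q x N e d k a =
      ∏ r, qPoch q (a * q * e * d * x r) (N r) * qPoch q (a * x r) (N r + 1) := by
  have hL : ContinuousAt (fun a => ∑ k ∈ Finset.Iic N, clearedTerm q x N e d k a) a :=
    tendsto_finsetSum _ fun k hk => continuousAt_clearedTerm (Finset.mem_Iic.1 hk) e d ha
  have h1 : ∀ (m : ℕ) (f : ℂ → ℂ), Continuous f → Continuous (fun a => qPoch q (f a) m) :=
    fun m f hf => (continuous_qPoch q m).comp hf
  have hR : ContinuousAt (fun a => ∏ r, qPoch q (a * q * e * d * x r) (N r) *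
      qPoch q (a * x r) (N r + 1)) a :=
    (continuous_finsetProd _ fun r _ =>
      (h1 _ _ (by fun_prop)).mul (h1 _ _ (by fun_prop))).continuousAt
  have hev : ∀ᶠ c in 𝓝[≠] a, ∑ k ∈ Finset.Iic N, clearedTerm q x N e d k c =
      ∏ r, qPoch q (c * q * e * d * x r) (N r) * qPoch q (c * x r) (N r + 1) := by
    have h2 : ∀ᶠ c in 𝓝[≠] a, ∀ r, qPoch q (c * x r) (2 * size N + 2) ≠ 0 :=
      Filter.eventually_all.2 fun r => eventually_qPoch_ne_zero hq0 (hx0 r) _ a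
    have h3 : ∀ᶠ c in 𝓝[≠] a, c ≠ 0 := by
      by_cases h0 : a = 0
      · rw [h0]; exact self_mem_nhdsWithin
      · exact nhdsWithin_le_nhds (isOpen_ne.mem_nhds h0)
    filter_upwards [h2, h3] with c hc hc0
    exact sum_clearedTerm_generic hq0 hq1 hx0 hx e d hc0 hc
  exact tendsto_nhds_unique (hL.tendsto.mono_left nhdsWithin_le_nhds)
    ((hR.tendsto.mono_left nhdsWithin_le_nhds).congr' (hev.mono fun c hc => hc.symm))

/-- The `6φ5` sum, multiplied by `∏_r (1 - a x_r)`, which is allowed to vanish. -/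
theorem sixPhiFive_mul {q : ℂ} (hq0 : q ≠ 0) (hq1 : ‖q‖ < 1) {x : Fin n → ℂ}
    (hx0 : ∀ r, x r ≠ 0) {N : Fin n → ℕ} (hx : Separated q x N) {a b c : ℂ} (hb : b ≠ 0)
    (hc : c ≠ 0) (ha : ∀ r, qPoch q (a * x r * q ^ (1 + N r)) (size N) ≠ 0)
    (hab : ∀ r, qPoch q (a * q * x r / b) (N r) ≠ 0)
    (hac : ∀ r, qPoch q (a * q * x r / c) (N r) ≠ 0) :
    ∑ k ∈ Finset.Iic N, chainCoeff q x N k * (a * q / (b * c)) ^ size k *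
        (qPoch q b (size k) * qPoch q c (size k)) *
        ∏ r, (1 - a * x r * q ^ (k r + size k)) * qPoch q (a * x r) (size k) /
          (qPoch q (a * x r * q ^ (1 + N r)) (size k) *
            (qPoch q (a * q * x r / b) (k r) * qPoch q (a * q * x r / c) (k r))) =
      ∏ r, qPoch q (a * q * x r / (b * c)) (N r) * qPoch q (a * x r) (N r + 1) /
        (qPoch q (a * q * x r / b) (N r) * qPoch q (a * q * x r / c) (N r)) := by
  have h := sum_clearedTerm hq0 hq1 hx0 hx (1 / b) (1 / c) ha
  rw [Finset.prod_div_distrib, eq_div_iff (Finset.prod_ne_zero_iff.2 fun r _ =>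
    mul_ne_zero (hab r) (hac r)), Finset.sum_mul]
  have hR : ∀ r, a * q * (1 / b) * (1 / c) * x r = a * q * x r / (b * c) := fun r => by
    field_simp
  simp_rw [hR] at h
  rw [← h]
  refine Finset.sum_congr rfl fun k hk => ?_
  have hk := Finset.mem_Iic.1 hk
  rw [clearedTerm, revPoch_inv hb, revPoch_inv hc, mul_assoc, ← Finset.prod_mul_distrib]
  have hP : ∀ r, (1 - a * x r * q ^ (k r + size k)) * qPoch q (a * x r) (size k) /
          (qPoch q (a * x r * q ^ (1 + N r)) (size k) *
            (qPoch q (a * q * x r / b) (k r) * qPoch q (a * q * x r / c) (k r))) *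
          (qPoch q (a * q * x r / b) (N r) * qPoch q (a * q * x r / c) (N r)) =
      qPoch q (a * q * (1 / b) * x r * q ^ k r) (N r - k r) *
      qPoch q (a * q * (1 / c) * x r * q ^ k r) (N r - k r) *
      ((1 - a * x r * q ^ (k r + size k)) * qPoch q (a * x r) (size k) /
        qPoch q (a * x r * q ^ (1 + N r)) (size k)) := by
    intro r
    have e1 := qPoch_add q (a * q * x r / b) (k r) (N r - k r)
    have e2 := qPoch_add q (a * q * x r / c) (k r) (N r - k r)
    rw [Nat.add_sub_cancel' (hk r)] at e1 e2
    have g1 := qPoch_ne_zero_of_le (hk r) (hab r)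
    have g2 := qPoch_ne_zero_of_le (hk r) (hac r)
    have g3 := qPoch_ne_zero_of_le (size_le_size hk) (ha r)
    have e3 : a * q * (1 / b) * x r = a * q * x r / b := by ring
    have e4 : a * q * (1 / c) * x r = a * q * x r / c := by ring
    rw [e1, e2, e3, e4]
    generalize qPoch q (a * q * x r / b) (k r) = D at *
    generalize qPoch q (a * q * x r / c) (k r) = E at *
    field_simp
  rw [Finset.prod_congr rfl fun r _ => hP r]
  have e5 : (a * q / (b * c)) ^ size k = (a * q) ^ size k / (b ^ size k * c ^ size k) := by
    rw [div_pow, mul_pow b c]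
  rw [e5]
  ring

/-! ### The Vandermonde factor -/

theorem prod_prod_eq_diag_mul_pairs {M : Type*} [CommMonoid M] (f : Fin n → Fin n → M) :
    ∏ r, ∏ s, f r s = (∏ r, f r r) * ∏ r, ∏ s ∈ Finset.Ioi r, f r s * f s r := by
  rw [Finset.prod_prod_Ioi_mul_eq_prod_prod_off_diag fun s r => f r s, ← Finset.prod_mul_distrib]
  exact Finset.prod_congr rfl fun r _ => Fintype.prod_eq_mul_prod_compl r _

theorem size_sq (k : Fin n → ℕ) : size k ^ 2 = ∑ r, k r ^ 2 + 2 * pairSum k := by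
  have h := prod_prod_eq_diag_mul_pairs (M := Multiplicative ℕ)
    fun r s => Multiplicative.ofAdd (k r * k s)
  have h2 : ∑ r, ∑ s, k r * k s = ∑ r, k r * k r +
      ∑ r, ∑ s ∈ Finset.Ioi r, (k r * k s + k s * k r) := h
  rw [size, sq, Finset.sum_mul_sum, h2, pairSum, Finset.mul_sum]
  congr 1
  · exact Finset.sum_congr rfl fun r _ => (sq _).symm
  · refine Finset.sum_congr rfl fun r _ => ?_
    rw [Finset.mul_sum]
    exact Finset.sum_congr rfl fun s _ => by ring

theorem weight_eq_sum_pairs (k : Fin n → ℕ) :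
    weight k = ∑ r, ∑ s ∈ Finset.Ioi r, k s := by
  rw [Finset.sum_comm' (t' := Finset.univ) (s' := fun s => Finset.Iio s) (by simp)]
  simp [weight]

/-- The contribution of a pair of indices `r < s` to `vandermonde_mul_lowerProd_self`, with
`y = x_r / x_s`, `k = k_r`, `l = k_s`. -/
theorem pair_identity {q y : ℂ} (hq : q ≠ 0) (hy : y ≠ 0) (hy1 : 1 - y ≠ 0) (k l : ℕ) :
    (1 - q ^ ((k : ℤ) - (l : ℤ)) * y) / (1 - y) *
      (qPoch q (q ^ (-(l : ℤ)) * y) k * qPoch q (q ^ (-(k : ℤ)) * (1 / y)) l) *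
      (q ^ (k * l) * q ^ l) = qPoch q (q * y) k * qPoch q (q * (1 / y)) l := by
  have hz : q ^ (-(k : ℤ)) * (1 / y) ≠ 0 := mul_ne_zero (zpow_ne_zero _ hq) (one_div_ne_zero hy)
  have hz2 : q * (1 / y) ≠ 0 := mul_ne_zero hq (one_div_ne_zero hy)
  have e1 : q ^ (1 - (l : ℤ)) / (q ^ (-(k : ℤ)) * (1 / y)) = q ^ (-(l : ℤ)) * y * q ^ k * q := by
    rw [sub_eq_add_neg, zpow_add₀ hq, zpow_neg q (k : ℤ), zpow_natCast, zpow_one]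
    field_simp
  have e2 : q ^ (1 - (l : ℤ)) / (q * (1 / y)) = q ^ (-(l : ℤ)) * y := by
    rw [sub_eq_add_neg, zpow_add₀ hq, zpow_one]
    field_simp
  have e3 : q ^ ((k : ℤ) - (l : ℤ)) * y = q ^ (-(l : ℤ)) * y * q ^ k := by
    rw [sub_eq_add_neg, zpow_add₀ hq, zpow_natCast]
    ring
  have e4 : (∏ i ∈ Finset.range l, -(q ^ (-(k : ℤ)) * (1 / y) * q ^ i)) * (q ^ (k * l) * q ^ l) =
      ∏ i ∈ Finset.range l, -(q * (1 / y) * q ^ i) := by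
    rw [pow_mul, ← mul_pow]
    nth_rw 2 [← Finset.card_range l]
    rw [← Finset.prod_const, ← Finset.prod_mul_distrib]
    refine Finset.prod_congr rfl fun i _ => ?_
    rw [zpow_neg, zpow_natCast]
    field_simp
  -- both sides reduce to `(q^(-l) y)_{k+l+1}`, split in two ways
  have e5 : qPoch q (q ^ (-(l : ℤ)) * y) k * ((1 - q ^ (-(l : ℤ)) * y * q ^ k) *
      qPoch q (q ^ (-(l : ℤ)) * y * q ^ k * q) l) =
      qPoch q (q ^ (-(l : ℤ)) * y) l * ((1 - y) * qPoch q (q * y) k) := by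
    have e6 : q ^ (-(l : ℤ)) * y * q ^ l = y := by
      rw [zpow_neg, zpow_natCast]; field_simp
    have h1 := qPoch_add q (q ^ (-(l : ℤ)) * y) k (l + 1)
    have h2 := qPoch_add q (q ^ (-(l : ℤ)) * y) l (k + 1)
    rw [qPoch_succ'] at h1 h2
    rw [e6, mul_comm y q] at h2
    rw [← h1, ← h2]
    congr 1
    omega
  rw [qPoch_reverse hq hz, qPoch_reverse hq hz2, e1, e2, e3, ← e4]
  generalize qPoch q (q * y) k = Q at *
  field_simp
  linear_combination (∏ i ∈ Finset.range l, -(q ^ (-(k : ℤ)) * q ^ i / y)) * e5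

/-- The Vandermonde factor turns `∏_{r,s} (q^(-k_s) x_r/x_s)_{k_r}` into
`∏_{r,s} (q x_r/x_s)_{k_r}`. -/
theorem vandermonde_mul_lowerProd_self {q : ℂ} (hq : q ≠ 0) {x : Fin n → ℂ}
    (hx0 : ∀ r, x r ≠ 0) (hx : ∀ r s, r ≠ s → x r ≠ x s) (k : Fin n → ℕ) :
    vandermonde q x k * lowerProd q x k k * (q ^ weight k * q ^ pairSum k *
      ∏ r, ∏ i ∈ Finset.range (k r), -(q * q ^ i)) = upperProd q x k := by
  have hdiag : ∀ r, qPoch q (q ^ (-(k r : ℤ)) * (x r / x r)) (k r) *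
      ∏ i ∈ Finset.range (k r), -(q * q ^ i) = qPoch q (q * (x r / x r)) (k r) := by
    intro r
    rw [div_self (hx0 r), mul_one, mul_one, qPoch_reverse hq hq (k r), sub_eq_add_neg,
      zpow_add₀ hq, zpow_one, mul_div_cancel_left₀ _ hq, mul_comm]
  have hw : q ^ weight k * q ^ pairSum k =
      ∏ r, ∏ s ∈ Finset.Ioi r, (q ^ (k r * k s) * q ^ k s) := by
    rw [weight_eq_sum_pairs, pairSum, mul_comm]
    simp_rw [Finset.prod_mul_distrib, Finset.prod_pow_eq_pow_sum]
  rw [lowerProd, upperProd, prod_prod_eq_diag_mul_pairs, prod_prod_eq_diag_mul_pairs, hw,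
    ← Finset.prod_congr rfl fun r _ => hdiag r, Finset.prod_mul_distrib]
  have hpair : vandermonde q x k * (∏ r, ∏ s ∈ Finset.Ioi r,
      qPoch q (q ^ (-(k s : ℤ)) * (x r / x s)) (k r) *
        qPoch q (q ^ (-(k r : ℤ)) * (x s / x r)) (k s)) *
      (∏ r, ∏ s ∈ Finset.Ioi r, (q ^ (k r * k s) * q ^ k s)) =
      ∏ r, ∏ s ∈ Finset.Ioi r, qPoch q (q * (x r / x s)) (k r) *
        qPoch q (q * (x s / x r)) (k s) := by
    rw [vandermonde]
    simp_rw [← Finset.prod_mul_distrib]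
    refine Finset.prod_congr rfl fun r _ => Finset.prod_congr rfl fun s hs => ?_
    have hrs : r ≠ s := (Finset.mem_Ioi.1 hs).ne
    have hy1 : 1 - x r / x s ≠ 0 := by
      rw [sub_ne_zero, ne_comm, Ne, div_eq_one_iff_eq (hx0 s)]
      exact hx r s hrs
    have := pair_identity hq (div_ne_zero (hx0 r) (hx0 s)) hy1 (k r) (k s)
    rwa [one_div_div] at this
  rw [← hpair]
  ring

theorem upperProd_ne_zero {q : ℂ} {x : Fin n → ℂ} {k N : Fin n → ℕ} (hk : k ≤ N)
    (hxq : ∀ r s, qPoch q (q * (x r / x s)) (N r) ≠ 0) : upperProd q x k ≠ 0 :=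
  Finset.prod_ne_zero_iff.2 fun r _ => Finset.prod_ne_zero_iff.2 fun s _ =>
    qPoch_ne_zero_of_le (hk r) (hxq r s)

/-- The coefficients of the `A_n` series in terms of `chainCoeff`. -/
theorem vandermonde_mul_div_eq_chainCoeff {q : ℂ} (hq : q ≠ 0) {x : Fin n → ℂ}
    (hx0 : ∀ r, x r ≠ 0) (hx : ∀ r s, r ≠ s → x r ≠ x s) {k N : Fin n → ℕ} (hk : k ≤ N)
    (hxq : ∀ r s, qPoch q (q * (x r / x s)) (N r) ≠ 0) :
    vandermonde q x k * (lowerProd q x N k / upperProd q x k) * (q ^ size N) ^ size k *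
      q ^ ((weight k : ℤ) - (pairSum k : ℤ)) * (∏ r, x r ^ k r) = chainCoeff q x N k := by
  have hU := upperProd_ne_zero hk hxq
  have hV := vandermonde_mul_lowerProd_self hq hx0 hx k
  have hne := hU
  rw [← hV] at hne
  obtain ⟨h1, h2⟩ := mul_ne_zero_iff.1 hne
  obtain ⟨h3, h4⟩ := mul_ne_zero_iff.1 h1
  obtain ⟨_, h5⟩ := mul_ne_zero_iff.1 h2
  have e1 : (∏ r, ∏ i ∈ Finset.range (k r), -(q * q ^ i)) * nodeProd q x k =
      q ^ (∑ r, k r ^ 2) * ∏ r, x r ^ k r := by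
    rw [nodeProd, ← Finset.prod_pow_eq_pow_sum, ← Finset.prod_mul_distrib,
      ← Finset.prod_mul_distrib]
    refine Finset.prod_congr rfl fun r _ => ?_
    rw [← Finset.prod_mul_distrib]
    generalize k r = m
    induction m with
    | zero => simp
    | succ m ih => rw [Finset.prod_range_succ, ih]; ring
  have e2 : (q ^ size N) ^ size k = q ^ (size k * (size N - size k)) *
      (q ^ (∑ r, k r ^ 2) * (q ^ pairSum k * q ^ pairSum k)) := by
    rw [← pow_mul, ← pow_add, ← pow_add, ← pow_add]
    congr 1
    have h6 := size_sq k
    obtain ⟨m, hm⟩ := Nat.exists_eq_add_of_le (size_le_size hk)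
    rw [hm, Nat.add_sub_cancel_left, ← two_mul, ← h6]
    ring
  rw [chainCoeff, ← hV, e2, zpow_sub₀ hq, zpow_natCast, zpow_natCast]
  generalize (∏ r, ∏ i ∈ Finset.range (k r), -(q * q ^ i)) = D at *
  field_simp
  linear_combination -lowerProd q x N k * e1

/-! ### Shifting the summation index -/

/-- The nodes `x_r q^(j_r)`, at which the chains start once `k` is replaced by `j + k`. -/
noncomputable def shift (q : ℂ) (x : Fin n → ℂ) (j : Fin n → ℕ) : Fin n → ℂ :=
  fun r => x r * q ^ j r

theorem lowerProd_add {q : ℂ} (hq : q ≠ 0) {x : Fin n → ℂ} (hx0 : ∀ r, x r ≠ 0)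
    {j m : Fin n → ℕ} (hm : j ≤ m) (k : Fin n → ℕ) :
    lowerProd q x m (j + k) = lowerProd q x m j * lowerProd q (shift q x j) (m - j) k := by
  simp only [lowerProd, ← Finset.prod_mul_distrib]
  refine Finset.prod_congr rfl fun r _ => Finset.prod_congr rfl fun s _ => ?_
  rw [Pi.add_apply, qPoch_add]
  congr 2
  have := hx0 s
  simp only [shift, Pi.sub_apply]
  rw [Nat.cast_sub (hm s), neg_sub, sub_eq_add_neg, zpow_add₀ hq, zpow_natCast]
  field_simp

theorem nodeProd_add (q : ℂ) (x : Fin n → ℂ) (j k : Fin n → ℕ) :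
    nodeProd q x (j + k) = nodeProd q x j * nodeProd q (shift q x j) k := by
  simp only [nodeProd, ← Finset.prod_mul_distrib]
  refine Finset.prod_congr rfl fun r _ => ?_
  rw [Pi.add_apply, Finset.prod_range_add]
  congr 1
  refine Finset.prod_congr rfl fun i _ => ?_
  rw [shift, pow_add]; ring

theorem size_sub {j N : Fin n → ℕ} (hj : j ≤ N) : size (N - j) = size N - size j := by
  have := size_add j (N - j)
  rw [add_tsub_cancel_of_le hj] at this
  omega

/-- Multiplying by `(q^(-k_s) x_r/x_s)_{j_r}`, which occurs in the sum over `j ≤ k`, makes the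
coefficient at `k = j + k'` a multiple of the one for the shifted nodes at `k'`. -/
theorem chainCoeff_add {q : ℂ} (hq : q ≠ 0) {x : Fin n → ℂ} (hx0 : ∀ r, x r ≠ 0)
    {j k N : Fin n → ℕ} (hj : j ≤ N) (hk : k ≤ N - j)
    (hne : lowerProd q x (j + k) (j + k) ≠ 0) :
    chainCoeff q x N (j + k) * lowerProd q x (j + k) j * (q ^ size j) ^ size k =
      lowerProd q x N j * nodeProd q x j * q ^ (size j * size (N - j)) *
        chainCoeff q (shift q x j) (N - j) k := by
  have hjk : j ≤ j + k := le_self_add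
  rw [lowerProd_add hq hx0 hjk k, add_tsub_cancel_left] at hne
  obtain ⟨h1, h2⟩ := mul_ne_zero_iff.1 hne
  have e1 : q ^ (size (j + k) * (size N - size (j + k))) * (q ^ size j) ^ size k =
      q ^ (size j * size (N - j)) * q ^ (size k * (size (N - j) - size k)) := by
    rw [← pow_mul, ← pow_add, ← pow_add, size_add]
    congr 1
    have h3 := size_le_size hk
    obtain ⟨m, hm⟩ := Nat.exists_eq_add_of_le h3
    have h4 : size N = size j + size (N - j) := by
      rw [size_sub hj]
      have := size_le_size hj
      omega
    rw [h4, hm, show size j + (size k + m) - (size j + size k) = m by omega,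
      Nat.add_sub_cancel_left]
    ring
  rw [chainCoeff, chainCoeff, lowerProd_add hq hx0 hj, lowerProd_add hq hx0 hjk,
    add_tsub_cancel_left, nodeProd_add]
  field_simp
  rw [← pow_mul] at e1
  linear_combination (lowerProd q x N j * lowerProd q (shift q x j) (N - j) k * nodeProd q x j *
    nodeProd q (shift q x j) k) * e1

theorem separated_of_qPoch_ne_zero {q : ℂ} (hq0 : q ≠ 0) {x : Fin n → ℂ}
    {N : Fin n → ℕ} (hx0 : ∀ r, x r ≠ 0) (hx : ∀ r s, r ≠ s → x r ≠ x s)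
    (hxq : ∀ r s, qPoch q (q * (x r / x s)) (N r) ≠ 0) : Separated q x N := by
  have key : ∀ r s, r ≠ s → ∀ m ≤ N r, x r * q ^ m ≠ x s := by
    intro r s hrs m hm h
    rcases m with _ | m
    · exact hx r s hrs (by simpa using h)
    · refine qPoch_ne_zero_iff.1 (hxq r s) m hm ?_
      have := hx0 s
      rw [← h]
      have := hx0 r
      field_simp
      ring
  intro r s hrs i hi j hj h
  rcases le_total i j with hij | hij
  · obtain ⟨m, rfl⟩ := Nat.exists_eq_add_of_le hij
    refine key s r hrs.symm m (by omega) ?_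
    refine mul_right_cancel₀ (pow_ne_zero i hq0) ?_
    rw [h, pow_add]; ring
  · obtain ⟨m, rfl⟩ := Nat.exists_eq_add_of_le hij
    refine key r s hrs m (by omega) ?_
    refine mul_right_cancel₀ (pow_ne_zero j hq0) ?_
    rw [← h, pow_add]; ring

theorem Separated.shift {q : ℂ} {x : Fin n → ℂ} {j N : Fin n → ℕ} (hx : Separated q x N)
    (hj : j ≤ N) : Separated q (shift q x j) (N - j) := by
  intro r s hrs i hi l hl
  have h1 : j r ≤ N r := hj r
  have h2 : j s ≤ N s := hj s
  rw [Pi.sub_apply] at hi hl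
  have := hx r s hrs (j r + i) (by omega) (j s + l) (by omega)
  simp only [AnSeries.shift]
  rwa [pow_add, pow_add, ← mul_assoc, ← mul_assoc] at this

/-- The binomial coefficient `|j| (|j| - 1) / 2` in terms of the `j_r (j_r - 1) / 2`. -/
theorem sum_range_size (j : Fin n → ℕ) :
    ∑ i ∈ Finset.range (size j), i = (∑ r, ∑ i ∈ Finset.range (j r), i) + pairSum j := by
  have h : ∀ m : ℕ, (∑ i ∈ Finset.range m, i) * 2 + m = m ^ 2 := by
    intro m
    rw [Finset.sum_range_id_mul_two]
    cases m with
    | zero => rfl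
    | succ m => rw [Nat.add_sub_cancel]; ring
  have h1 := h (size j)
  have h2 := size_sq j
  have h3 : (∑ r, ∑ i ∈ Finset.range (j r), i) * 2 + size j = ∑ r, j r ^ 2 := by
    rw [size, Finset.sum_mul, ← Finset.sum_add_distrib]
    exact Finset.sum_congr rfl fun r _ => h (j r)
  omega

/-- The powers of `q` and of the `x_r` that the summation over `k` leaves for a fixed `j`. -/
theorem residual_factor {q a b A : ℂ} (ha : a ≠ 0) (hb : b ≠ 0) (hA : A ≠ 0)
    {x : Fin n → ℂ} (hx0 : ∀ r, x r ≠ 0) (j : Fin n → ℕ) :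
    (∏ i ∈ Finset.range (size j), -(a / b * q ^ i)) * A ^ size j * (b * q / (a * A)) ^ size j *
      q ^ pairSum j * (∏ r, x r ^ (-(j r : ℤ))) * nodeProd q x j = (q ^ size j) ^ size j := by
  have e1 : ∀ (y : ℂ) (m : ℕ), ∏ i ∈ Finset.range m, -(y * q ^ i) =
      (-y) ^ m * q ^ (∑ i ∈ Finset.range m, i) := by
    intro y m
    rw [← Finset.prod_pow_eq_pow_sum]
    nth_rw 2 [← Finset.card_range m]
    rw [← Finset.prod_const, ← Finset.prod_mul_distrib]
    exact Finset.prod_congr rfl fun i _ => by ring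
  have e2 : (∏ r, x r ^ (-(j r : ℤ))) * nodeProd q x j =
      (-1) ^ size j * q ^ (∑ r, ∑ i ∈ Finset.range (j r), i) := by
    rw [nodeProd, size, ← Finset.prod_pow_eq_pow_sum, ← Finset.prod_pow_eq_pow_sum,
      ← Finset.prod_mul_distrib, ← Finset.prod_mul_distrib]
    refine Finset.prod_congr rfl fun r _ => ?_
    have := hx0 r
    rw [e1, neg_pow, zpow_neg, zpow_natCast]
    field_simp
  have e3 : (q ^ size j) ^ size j = q ^ (∑ i ∈ Finset.range (size j), i) *
      q ^ (∑ i ∈ Finset.range (size j), i) * q ^ size j := by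
    rw [← pow_mul, ← pow_add, ← pow_add, ← mul_two, Finset.sum_range_id_mul_two]
    congr 1
    cases size j with
    | zero => rfl
    | succ m => rw [Nat.add_sub_cancel]; ring
  have e4 : (-(a / b)) ^ size j * A ^ size j * (b * q / (a * A)) ^ size j * (-1) ^ size j =
      q ^ size j := by
    rw [← mul_pow, ← mul_pow, ← mul_pow]
    congr 1
    field_simp
  have e5 : q ^ (∑ i ∈ Finset.range (size j), i) =
      q ^ (∑ r, ∑ i ∈ Finset.range (j r), i) * q ^ pairSum j := by
    rw [sum_range_size, pow_add]
  rw [mul_assoc _ (∏ r, x r ^ (-(j r : ℤ))), e2, e1, e3, ← e4]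
  nth_rw 3 [e5]
  ring

/-- The factors of index `r` in the double sum, for `k = j + k'`: the part depending on `j` times
the corresponding factor of the `6φ5` sum with `a`, `x_r` replaced by `a q^|j|`, `x_r q^(j_r)`.
Here `j, k, N` stand for `j_r, k'_r, N_r - j_r` and `l, t` for `|j|, |k'|`. -/
theorem factor_add {q a b A : ℂ} (ha : a ≠ 0) (hb : b ≠ 0) (hA : A ≠ 0) (hq : q ≠ 0) (x : ℂ)
    (j k N l t : ℕ) :
    (1 - a * x * q ^ (j + k + (l + t))) / (1 - a * x) *
      (qPoch q (a * x) (l + t) / (qPoch q (a * x * q ^ (1 + (j + N))) (l + t) *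
        (qPoch q (b * q * x) (j + k) * qPoch q (a * A * x / b) (j + k)))) *
      ((1 - b * x * q ^ (j + l)) * (qPoch q (a * x * q ^ (l + t)) j * qPoch q (A * x) j) /
        ((1 - b * x) * qPoch q (b * x * q ^ (j + k + 1)) l)) =
    ((1 - b * x * q ^ (j + l)) * (qPoch q (a * x) (l + j) * qPoch q (A * x) j) /
      ((1 - b * x) * (1 - a * x) * qPoch q (a * x * q ^ (1 + (j + N))) l *
        (qPoch q (b * q * x) (j + l) * qPoch q (a * A * x / b) j))) *
    ((1 - a * q ^ l * (x * q ^ j) * q ^ (k + t)) * qPoch q (a * q ^ l * (x * q ^ j)) t /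
      (qPoch q (a * q ^ l * (x * q ^ j) * q ^ (1 + N)) t *
        (qPoch q (a * q ^ l * q * (x * q ^ j) / (a / b)) k *
          qPoch q (a * q ^ l * q * (x * q ^ j) / (b * q / A * q ^ l)) k))) := by
  have i1 : a * x * q ^ (j + k + (l + t)) = a * q ^ l * (x * q ^ j) * q ^ (k + t) := by ring
  have i2 : qPoch q (a * x) (l + t) * qPoch q (a * x * q ^ (l + t)) j =
      qPoch q (a * x) (l + j) * qPoch q (a * q ^ l * (x * q ^ j)) t := by
    rw [← qPoch_add, show a * q ^ l * (x * q ^ j) = a * x * q ^ (l + j) by ring, ← qPoch_add]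
    congr 1
    omega
  have i3 : qPoch q (a * x * q ^ (1 + (j + N))) (l + t) =
      qPoch q (a * x * q ^ (1 + (j + N))) l *
        qPoch q (a * q ^ l * (x * q ^ j) * q ^ (1 + N)) t := by
    rw [qPoch_add]
    congr 2
    ring
  have i4 : qPoch q (b * q * x) (j + k) * qPoch q (b * x * q ^ (j + k + 1)) l =
      qPoch q (b * q * x) (j + l) *
        qPoch q (a * q ^ l * q * (x * q ^ j) / (a / b)) k := by
    rw [show b * x * q ^ (j + k + 1) = b * q * x * q ^ (j + k) by ring, ← qPoch_add,
      show a * q ^ l * q * (x * q ^ j) / (a / b) = b * q * x * q ^ (j + l) by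
        field_simp; ring, ← qPoch_add]
    congr 1
    omega
  have i5 : qPoch q (a * A * x / b) (j + k) = qPoch q (a * A * x / b) j *
      qPoch q (a * q ^ l * q * (x * q ^ j) / (b * q / A * q ^ l)) k := by
    rw [qPoch_add]
    congr 2
    field_simp
  rw [i1, i3, i5]
  calc _ = (1 - a * q ^ l * (x * q ^ j) * q ^ (k + t)) * (1 - b * x * q ^ (j + l)) *
        qPoch q (A * x) j * (qPoch q (a * x) (l + t) * qPoch q (a * x * q ^ (l + t)) j) /
        ((1 - a * x) * (1 - b * x) * qPoch q (a * x * q ^ (1 + (j + N))) l *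
        qPoch q (a * q ^ l * (x * q ^ j) * q ^ (1 + N)) t * qPoch q (a * A * x / b) j *
      qPoch q (a * q ^ l * q * (x * q ^ j) / (b * q / A * q ^ l)) k *
      (qPoch q (b * q * x) (j + k) * qPoch q (b * x * q ^ (j + k + 1)) l)) := by
        simp only [div_eq_mul_inv, mul_inv]; ring
    _ = _ := by
      rw [i2, i4]
      simp only [div_eq_mul_inv, mul_inv]; ring

/-- The factors of index `r` after the summation over `k`, in the notation of `factor_add`. -/
theorem factor_sum {q a b A : ℂ} (ha : a ≠ 0) (hb : b ≠ 0) (hA : A ≠ 0) (hq : q ≠ 0) {x : ℂ}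
    (j N l : ℕ) (hax : 1 - a * x ≠ 0) (haN : qPoch q (a * x * q ^ (1 + (j + N))) l ≠ 0) :
    ((1 - b * x * q ^ (j + l)) * (qPoch q (a * x) (l + j) * qPoch q (A * x) j) /
      ((1 - b * x) * (1 - a * x) * qPoch q (a * x * q ^ (1 + (j + N))) l *
        (qPoch q (b * q * x) (j + l) * qPoch q (a * A * x / b) j))) *
    (qPoch q (a * q ^ l * q * (x * q ^ j) / (a / b * (b * q / A * q ^ l))) N *
        qPoch q (a * q ^ l * (x * q ^ j)) (N + 1) /
      (qPoch q (a * q ^ l * q * (x * q ^ j) / (a / b)) N *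
          qPoch q (a * q ^ l * q * (x * q ^ j) / (b * q / A * q ^ l)) N)) =
    qPoch q (A * x) (j + N) * qPoch q (a * q * x) (j + N) /
      (qPoch q (a * A * x / b) (j + N) * qPoch q (b * q * x) (j + N)) *
    ((1 - b * x * q ^ (j + l)) / ((1 - b * x) * qPoch q (b * x * q ^ (1 + (j + N))) l)) := by
  have i1 : qPoch q (A * x) j *
      qPoch q (a * q ^ l * q * (x * q ^ j) / (a / b * (b * q / A * q ^ l))) N =
      qPoch q (A * x) (j + N) := by
    rw [qPoch_add]
    congr 2
    field_simp
  have i2 : qPoch q (a * x) (l + j) * qPoch q (a * q ^ l * (x * q ^ j)) (N + 1) =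
      (1 - a * x) * qPoch q (a * q * x) (j + N) * qPoch q (a * x * q ^ (1 + (j + N))) l := by
    rw [show a * q ^ l * (x * q ^ j) = a * x * q ^ (l + j) by ring, ← qPoch_add,
      show a * q * x = a * x * q by ring, ← qPoch_succ', add_comm 1 (j + N), ← qPoch_add]
    congr 1
    omega
  have i4 : qPoch q (b * q * x) (j + l) *
        qPoch q (a * q ^ l * q * (x * q ^ j) / (a / b)) N =
      qPoch q (b * q * x) (j + N) * qPoch q (b * x * q ^ (1 + (j + N))) l := by
    rw [show b * x * q ^ (1 + (j + N)) = b * q * x * q ^ (j + N) by ring, ← qPoch_add,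
      show a * q ^ l * q * (x * q ^ j) / (a / b) = b * q * x * q ^ (j + l) by
        field_simp; ring, ← qPoch_add]
    congr 1
    omega
  have i5 : qPoch q (a * A * x / b) j *
      qPoch q (a * q ^ l * q * (x * q ^ j) / (b * q / A * q ^ l)) N =
      qPoch q (a * A * x / b) (j + N) := by
    rw [qPoch_add]
    congr 2
    field_simp
  calc _ = (1 - b * x * q ^ (j + l)) * (qPoch q (A * x) j *
      qPoch q (a * q ^ l * q * (x * q ^ j) / (a / b * (b * q / A * q ^ l))) N) *
      (qPoch q (a * x) (l + j) * qPoch q (a * q ^ l * (x * q ^ j)) (N + 1)) /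
      ((1 - b * x) * (1 - a * x) * qPoch q (a * x * q ^ (1 + (j + N))) l *
      (qPoch q (b * q * x) (j + l) * qPoch q (a * q ^ l * q * (x * q ^ j) / (a / b)) N) *
      (qPoch q (a * A * x / b) j *
      qPoch q (a * q ^ l * q * (x * q ^ j) / (b * q / A * q ^ l)) N)) := by
        simp only [div_eq_mul_inv, mul_inv]; ring
    _ = _ := by
      rw [i1, i2, i4, i5]
      generalize qPoch q (a * x * q ^ (1 + (j + N))) l = D at *
      generalize 1 - a * x = E at *
      generalize qPoch q (A * x) (j + N) = F1
      generalize qPoch q (a * q * x) (j + N) = F2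
      generalize qPoch q (a * A * x / b) (j + N) = F3
      generalize qPoch q (b * q * x) (j + N) = F4
      generalize qPoch q (b * x * q ^ (1 + (j + N))) l = F5
      generalize 1 - b * x * q ^ (j + l) = F6
      generalize 1 - b * x = F7
      field_simp

/-! ### The transformation formula -/

theorem sum_Iic_comm_shift {M : Type*} [AddCommMonoid M] (N : Fin n → ℕ)
    (f : (Fin n → ℕ) → (Fin n → ℕ) → M) :
    ∑ k ∈ Finset.Iic N, ∑ j ∈ Finset.Iic k, f k j =
      ∑ j ∈ Finset.Iic N, ∑ k ∈ Finset.Iic (N - j), f (j + k) j := by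
  rw [Finset.sum_comm' (t' := Finset.Iic N) (s' := fun j => Finset.Icc j N)]
  · refine Finset.sum_congr rfl fun j hj => ?_
    have hj := Finset.mem_Iic.1 hj
    refine Finset.sum_nbij' (fun k => k - j) (fun k => j + k) ?_ ?_ ?_ ?_ ?_
    · intro k hk
      exact Finset.mem_Iic.2 (tsub_le_tsub_right (Finset.mem_Icc.1 hk).2 j)
    · intro k hk
      refine Finset.mem_Icc.2 ⟨le_self_add, ?_⟩
      exact (add_le_add_right (Finset.mem_Iic.1 hk) j).trans (add_tsub_cancel_of_le hj).le
    · intro k hk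
      exact add_tsub_cancel_of_le (Finset.mem_Icc.1 hk).1
    · intro k _
      exact add_tsub_cancel_left j k
    · intro k hk
      rw [add_tsub_cancel_of_le (Finset.mem_Icc.1 hk).1]
  · intro k j
    simp only [Finset.mem_Iic, Finset.mem_Icc]
    exact ⟨fun h => ⟨⟨h.2, h.1⟩, h.2.trans h.1⟩, fun h => ⟨h.1.2, h.1.1⟩⟩

/-- For fixed `j`, the sum over `k = j + k'` in the transformation formula is a `6φ5` sum with
parameters `a q^|j|`, `a / b`, `b q^(1 + |j|) / A` and nodes `x_r q^(j_r)`. -/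
theorem inner_sum {q : ℂ} (hq0 : q ≠ 0) (hq1 : ‖q‖ < 1) {x : Fin n → ℂ} {N j : Fin n → ℕ}
    (hx0 : ∀ r, x r ≠ 0) (hx : ∀ r s, r ≠ s → x r ≠ x s)
    (hxq : ∀ r s, qPoch q (q * (x r / x s)) (N r) ≠ 0) {a b A : ℂ} (hj : j ≤ N)
    (ha : a ≠ 0) (hb : b ≠ 0) (hA : A ≠ 0) (hax : ∀ r, 1 - a * x r ≠ 0)
    (haN : ∀ r, qPoch q (a * x r * q ^ (1 + N r)) (size N) ≠ 0)
    (hbN : ∀ r, qPoch q (b * q * x r) (N r) ≠ 0)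
    (hbk : ∀ k ≤ N, ∀ r, qPoch q (b * x r * q ^ (k r + 1)) (size k) ≠ 0)
    (haA : ∀ r, qPoch q (a * A * x r / b) (N r) ≠ 0)
    (hbA : qPoch q (b * q / A) (size N) ≠ 0)
    (hba : ∀ k ≤ N, qPoch q (b * q ^ (1 - (size k : ℤ)) / a) (size k) ≠ 0) :
    ∑ k ∈ Finset.Iic (N - j), vandermonde q x (j + k) *
          (lowerProd q x N (j + k) / upperProd q x (j + k)) *
          (∏ r, (1 - a * x r * q ^ ((j + k) r + size (j + k))) / (1 - a * x r)) *
          (∏ r, qPoch q (a * x r) (size (j + k)) /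
            (qPoch q (a * x r * q ^ (1 + N r)) (size (j + k)) *
              (qPoch q (b * q * x r) ((j + k) r) * qPoch q (a * A * x r / b) ((j + k) r)))) *
          (qPoch q (a / b) (size (j + k)) * qPoch q (b * q / A) (size (j + k))) *
          (A * q ^ size N) ^ size (j + k) *
          q ^ ((weight (j + k) : ℤ) - (pairSum (j + k) : ℤ)) * (∏ r, x r ^ (j + k) r) *
          (vandermonde q x j * lowerProd q x (j + k) j *
            (∏ r, (1 - b * x r * q ^ (j r + size j)) *
                (qPoch q (a * x r * q ^ size (j + k)) (j r) * qPoch q (A * x r) (j r)) /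
              ((1 - b * x r) * qPoch q (b * x r * q ^ ((j + k) r + 1)) (size j))) *
            (1 / (qPoch q (b * q / A) (size j) *
              qPoch q (b * q ^ (1 - (size (j + k) : ℤ)) / a) (size j))) *
            (b * q / (a * A)) ^ size j *
            q ^ (weight j + pairSum j) * (∏ r, x r ^ (-(j r : ℤ)))) =
      (∏ r, qPoch q (A * x r) (N r) * qPoch q (a * q * x r) (N r) /
          (qPoch q (a * A * x r / b) (N r) * qPoch q (b * q * x r) (N r))) *
        (vandermonde q x j * lowerProd q x N j *
          (∏ r, (1 - b * x r * q ^ (j r + size j)) /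
            ((1 - b * x r) * qPoch q (b * x r * q ^ (1 + N r)) (size j))) *
          q ^ (size j * size N) * q ^ weight j) := by
  have hN : ∀ r, N r = j r + (N - j) r := fun r => (Nat.add_sub_cancel' (hj r)).symm
  have hNs : size N = size j + size (N - j) := by
    rw [← size_add, add_tsub_cancel_of_le hj]
  have hdiv : a / b ≠ 0 := div_ne_zero ha hb
  have hc : b * q / A * q ^ size j ≠ 0 := by positivity
  have hsep := (separated_of_qPoch_ne_zero hq0 hx0 hx hxq).shift hj
  have hx0' : ∀ r, shift q x j r ≠ 0 := fun r => mul_ne_zero (hx0 r) (pow_ne_zero _ hq0)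
  have key := sixPhiFive_mul hq0 hq1 hx0' hsep (a := a * q ^ size j) hdiv hc
    (fun r => by
      have := haN r
      rw [hNs, qPoch_add] at this
      convert right_ne_zero_of_mul this using 2
      rw [shift, hN r, pow_add, pow_add, pow_add]
      ring)
    (fun r => by
      -- these factors are split between `(b q x_r)_{N_r}` and `(b x_r q^(N_r + 1))_{|N|}`
      have h1 := mul_ne_zero (hbN r) (hbk N le_rfl r)
      rw [show b * x r * q ^ (N r + 1) = b * q * x r * q ^ N r by ring, ← qPoch_add,
        show N r + size N = (j r + size j) + ((N - j) r + size (N - j)) by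
          have := hN r; omega, qPoch_add] at h1
      have h2 := qPoch_ne_zero_of_le (Nat.le_add_right _ _) (right_ne_zero_of_mul h1)
      convert h2 using 2
      rw [shift, pow_add]
      field_simp)
    (fun r => by
      have h1 := haA r
      rw [hN r, qPoch_add] at h1
      convert right_ne_zero_of_mul h1 using 2
      rw [shift]
      field_simp)
  have hA' : a * q ^ size j * q / (a / b * (b * q / A * q ^ size j)) = A := by
    field_simp
  rw [hA'] at key
  set P : Fin n → ℂ := fun r =>
    ((1 - b * x r * q ^ (j r + size j)) *
      (qPoch q (a * x r) (size j + j r) * qPoch q (A * x r) (j r)) /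
      ((1 - b * x r) * (1 - a * x r) * qPoch q (a * x r * q ^ (1 + N r)) (size j) *
        (qPoch q (b * q * x r) (j r + size j) * qPoch q (a * A * x r / b) (j r)))) with hP
  have hend : (∏ r, P r) * (∏ r, qPoch q (a * q ^ size j * q * shift q x j r /
        (a / b * (b * q / A * q ^ size j))) ((N - j) r) *
      qPoch q (a * q ^ size j * shift q x j r) ((N - j) r + 1) /
      (qPoch q (a * q ^ size j * q * shift q x j r / (a / b)) ((N - j) r) *
      qPoch q (a * q ^ size j * q * shift q x j r / (b * q / A * q ^ size j)) ((N - j) r))) =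
      (∏ r, qPoch q (A * x r) (N r) * qPoch q (a * q * x r) (N r) /
          (qPoch q (a * A * x r / b) (N r) * qPoch q (b * q * x r) (N r))) *
      ∏ r, (1 - b * x r * q ^ (j r + size j)) /
            ((1 - b * x r) * qPoch q (b * x r * q ^ (1 + N r)) (size j)) := by
    rw [← Finset.prod_mul_distrib, ← Finset.prod_mul_distrib]
    refine Finset.prod_congr rfl fun r _ => ?_
    have h1 := qPoch_ne_zero_of_le (size_le_size hj) (haN r)
    rw [hN r] at h1
    rw [hP]
    simp only [shift]
    rw [hN r]
    exact factor_sum ha hb hA hq0 (j r) ((N - j) r) (size j) (hax r) h1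
  have hpow : q ^ (size j * size N) = (q ^ size j) ^ size j * q ^ (size j * size (N - j)) := by
    rw [← pow_mul, ← pow_add, hNs, mul_add]
  rw [show ∀ u v w z y t : ℂ, u * (v * w * z * y * t) = v * w * y * t * (u * z) by intros; ring,
    ← hend, ← key, hpow, ← residual_factor ha hb hA hx0 j, mul_comm (∏ r, P r), Finset.sum_mul,
    Finset.mul_sum]
  refine Finset.sum_congr rfl fun k hk => ?_
  have hk := Finset.mem_Iic.1 hk
  have hjk : j + k ≤ N := (add_le_add_right hk j).trans (add_tsub_cancel_of_le hj).le
  have hU := upperProd_ne_zero hjk hxq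
  have hlow : lowerProd q x (j + k) (j + k) ≠ 0 := by
    rw [← vandermonde_mul_lowerProd_self hq0 hx0 hx (j + k)] at hU
    exact right_ne_zero_of_mul (left_ne_zero_of_mul hU)
  have hcoef := vandermonde_mul_div_eq_chainCoeff hq0 hx0 hx hjk hxq
  have hadd := chainCoeff_add hq0 hx0 hj hk hlow
  set S : ℂ := ∏ r, (1 - a * q ^ size j * shift q x j r * q ^ (k r + size k)) *
          qPoch q (a * q ^ size j * shift q x j r) (size k) /
          (qPoch q (a * q ^ size j * shift q x j r * q ^ (1 + (N - j) r)) (size k) *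
            (qPoch q (a * q ^ size j * q * shift q x j r / (a / b)) (k r) *
            qPoch q (a * q ^ size j * q * shift q x j r / (b * q / A * q ^ size j)) (k r))) with hS
  have hfac : (∏ r, (1 - a * x r * q ^ ((j + k) r + size (j + k))) / (1 - a * x r)) *
          (∏ r, qPoch q (a * x r) (size (j + k)) /
            (qPoch q (a * x r * q ^ (1 + N r)) (size (j + k)) *
              (qPoch q (b * q * x r) ((j + k) r) * qPoch q (a * A * x r / b) ((j + k) r)))) *
          (∏ r, (1 - b * x r * q ^ (j r + size j)) *
                (qPoch q (a * x r * q ^ size (j + k)) (j r) * qPoch q (A * x r) (j r)) /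
              ((1 - b * x r) * qPoch q (b * x r * q ^ ((j + k) r + 1)) (size j))) =
      (∏ r, P r) * S := by
    rw [hS]
    simp_rw [← Finset.prod_mul_distrib]
    refine Finset.prod_congr rfl fun r _ => ?_
    rw [hP]
    simp only [shift, Pi.add_apply, size_add]
    rw [hN r]
    exact factor_add ha hb hA hq0 (x r) (j r) (k r) ((N - j) r) (size j) (size k)
  have hbA' : qPoch q (b * q / A) (size (j + k)) * (qPoch q (b * q / A) (size j))⁻¹ =
      qPoch q (b * q / A * q ^ size j) (size k) := by
    have h1 := qPoch_ne_zero_of_le (size_le_size hj) hbA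
    rw [size_add, qPoch_add]
    field_simp
  have hab' : qPoch q (a / b) (size (j + k)) *
      (qPoch q (b * q ^ (1 - (size (j + k) : ℤ)) / a) (size j))⁻¹ =
      qPoch q (a / b) (size k) * (q ^ size j) ^ size k *
        ∏ i ∈ Finset.range (size j), -(a / b * q ^ i) := by
    have h1 := qPoch_ne_zero_of_le (size_le_size (le_self_add : j ≤ j + k)) (hba _ hjk)
    rw [← div_eq_mul_inv, div_eq_iff h1, size_add, add_comm (size j), qPoch_add,
      qPoch_reverse hq0 (by positivity : a / b * q ^ size k ≠ 0)]
    have e1 : q ^ (1 - (size j : ℤ)) / (a / b * q ^ size k) =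
        b * q ^ (1 - ((size k + size j : ℕ) : ℤ)) / a := by
      rw [show (1 - ((size k + size j : ℕ) : ℤ)) = (1 - (size j : ℤ)) - (size k : ℤ) by
        push_cast; ring, zpow_sub₀ hq0 _ (size k : ℤ), zpow_natCast]
      field_simp
    have e2 : ∏ i ∈ Finset.range (size j), -(a / b * q ^ size k * q ^ i) =
        (q ^ size j) ^ size k * ∏ i ∈ Finset.range (size j), -(a / b * q ^ i) := by
      generalize size j = m
      induction m with
      | zero => simp
      | succ m ih => rw [Finset.prod_range_succ, Finset.prod_range_succ, ih]; ring
    rw [e1, e2]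
    ring
  calc _ = (vandermonde q x (j + k) * (lowerProd q x N (j + k) / upperProd q x (j + k)) *
        (q ^ size N) ^ size (j + k) * q ^ ((weight (j + k) : ℤ) - (pairSum (j + k) : ℤ)) *
        (∏ r, x r ^ (j + k) r)) * ((∏ r, (1 - a * x r * q ^ ((j + k) r + size (j + k))) /
            (1 - a * x r)) *
          (∏ r, qPoch q (a * x r) (size (j + k)) /
            (qPoch q (a * x r * q ^ (1 + N r)) (size (j + k)) *
              (qPoch q (b * q * x r) ((j + k) r) * qPoch q (a * A * x r / b) ((j + k) r)))) *
          (∏ r, (1 - b * x r * q ^ (j r + size j)) *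
                (qPoch q (a * x r * q ^ size (j + k)) (j r) * qPoch q (A * x r) (j r)) /
              ((1 - b * x r) * qPoch q (b * x r * q ^ ((j + k) r + 1)) (size j)))) *
        (qPoch q (b * q / A) (size (j + k)) * (qPoch q (b * q / A) (size j))⁻¹) *
        (qPoch q (a / b) (size (j + k)) *
          (qPoch q (b * q ^ (1 - (size (j + k) : ℤ)) / a) (size j))⁻¹) *
        (A ^ size (j + k) * (vandermonde q x j * lowerProd q x (j + k) j *
          (b * q / (a * A)) ^ size j * q ^ (weight j + pairSum j) *
          ∏ r, x r ^ (-(j r : ℤ)))) := by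
        rw [mul_pow A, one_div, mul_inv]
        ring
    _ = _ := by
        rw [hcoef, hfac, hbA', hab', size_add, pow_add A, pow_add q (weight j)]
        linear_combination ((∏ r, P r) * S * qPoch q (b * q / A * q ^ size j) (size k) *
          qPoch q (a / b) (size k) * (∏ i ∈ Finset.range (size j), -(a / b * q ^ i)) *
          A ^ size j * A ^ size k * vandermonde q x j * (b * q / (a * A)) ^ size j *
          q ^ weight j * q ^ pairSum j * ∏ r, x r ^ (-(j r : ℤ))) * hadd

end AnSeries

open AnSeries in
theorem mainTheorem3 (n : ℕ) (q : ℂ) (hq0 : q ≠ 0) (hq1 : ‖q‖ < 1)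
    (x : Fin n → ℂ) (N : Fin n → ℕ)
    (hx0 : ∀ r, x r ≠ 0)
    (hx : ∀ r s, r ≠ s → x r ≠ x s)
    (hxq : ∀ r s, qPoch q (q * (x r / x s)) (N r) ≠ 0) :
    -- the transformation formula
    (∀ (a b A : ℂ) (β : (Fin n → ℕ) → ℂ),
      a ≠ 0 → b ≠ 0 → A ≠ 0 →
      (∀ r, 1 - a * x r ≠ 0) →
      (∀ r, qPoch q (a * x r * q ^ (1 + N r)) (size N) ≠ 0) →
      (∀ r, 1 - b * x r ≠ 0) →
      (∀ r, qPoch q (b * q * x r) (N r) ≠ 0) →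
      (∀ k ≤ N, ∀ r, qPoch q (b * x r * q ^ (k r + 1)) (size k) ≠ 0) →
      (∀ r, qPoch q (a * A * x r / b) (N r) ≠ 0) →
      qPoch q (b * q / A) (size N) ≠ 0 →
      (∀ k ≤ N, qPoch q (b * q ^ (1 - (size k : ℤ)) / a) (size k) ≠ 0) →
      (∏ r, qPoch q (A * x r) (N r) * qPoch q (a * q * x r) (N r) /
          (qPoch q (a * A * x r / b) (N r) * qPoch q (b * q * x r) (N r))) *
        ∑ j ∈ Finset.Iic N,
          vandermonde q x j * lowerProd q x N j *
          (∏ r, (1 - b * x r * q ^ (j r + size j)) /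
            ((1 - b * x r) * qPoch q (b * x r * q ^ (1 + N r)) (size j))) *
          q ^ (size j * size N) * q ^ weight j * β j
      = ∑ k ∈ Finset.Iic N,
          vandermonde q x k * (lowerProd q x N k / upperProd q x k) *
          (∏ r, (1 - a * x r * q ^ (k r + size k)) / (1 - a * x r)) *
          (∏ r, qPoch q (a * x r) (size k) /
            (qPoch q (a * x r * q ^ (1 + N r)) (size k) *
              (qPoch q (b * q * x r) (k r) * qPoch q (a * A * x r / b) (k r)))) *
          (qPoch q (a / b) (size k) * qPoch q (b * q / A) (size k)) *
          (A * q ^ size N) ^ size k *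
          q ^ ((weight k : ℤ) - (pairSum k : ℤ)) * (∏ r, x r ^ k r) *
          ∑ j ∈ Finset.Iic k,
            vandermonde q x j * lowerProd q x k j *
            (∏ r, (1 - b * x r * q ^ (j r + size j)) *
                (qPoch q (a * x r * q ^ size k) (j r) * qPoch q (A * x r) (j r)) /
              ((1 - b * x r) * qPoch q (b * x r * q ^ (k r + 1)) (size j))) *
            (1 / (qPoch q (b * q / A) (size j) *
              qPoch q (b * q ^ (1 - (size k : ℤ)) / a) (size j))) *
            (b * q / (a * A)) ^ size j *
            q ^ (weight j + pairSum j) * (∏ r, x r ^ (-(j r : ℤ))) * β j) ∧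
    -- the terminating very-well-poised sum that it contains:
    -- `β` the delta at `0`, `b` replaced by `a / b`, and `A` by `a q / (b c)`
    (∀ a b c : ℂ,
      b ≠ 0 → c ≠ 0 →
      (∀ r, 1 - a * x r ≠ 0) →
      (∀ r, qPoch q (a * x r * q ^ (1 + N r)) (size N) ≠ 0) →
      (∀ r, qPoch q (a * q * x r / b) (N r) ≠ 0) →
      (∀ r, qPoch q (a * q * x r / c) (N r) ≠ 0) →
      (∏ r, qPoch q (a * q * x r / (b * c)) (N r) * qPoch q (a * q * x r) (N r) /
          (qPoch q (a * q * x r / b) (N r) * qPoch q (a * q * x r / c) (N r)))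
      = ∑ k ∈ Finset.Iic N,
          vandermonde q x k * (lowerProd q x N k / upperProd q x k) *
          (∏ r, (1 - a * x r * q ^ (k r + size k)) / (1 - a * x r)) *
          (∏ r, qPoch q (a * x r) (size k) /
            (qPoch q (a * x r * q ^ (1 + N r)) (size k) *
              (qPoch q (a * q * x r / b) (k r) * qPoch q (a * q * x r / c) (k r)))) *
          (qPoch q b (size k) * qPoch q c (size k)) *
          (a * q ^ (1 + size N) / (b * c)) ^ size k *
          q ^ ((weight k : ℤ) - (pairSum k : ℤ)) * (∏ r, x r ^ k r)) := by
  have hsep := separated_of_qPoch_ne_zero hq0 hx0 hx hxq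
  refine ⟨?_, ?_⟩
  · intro a b A β ha hb hA hax haN hbx hbN hbk haA hbA hba
    simp_rw [Finset.mul_sum]
    rw [sum_Iic_comm_shift]
    refine Finset.sum_congr rfl fun j hj => ?_
    have h := inner_sum hq0 hq1 hx0 hx hxq (Finset.mem_Iic.1 hj) ha hb hA hax haN hbN hbk haA
      hbA hba
    rw [← mul_assoc _ _ (β j), ← h, Finset.sum_mul]
    exact Finset.sum_congr rfl fun k _ => (mul_assoc _ _ (β j))
  · intro a b c hb hc hax haN hab hac
    have h := sixPhiFive_mul hq0 hq1 hx0 hsep hb hc haN hab hac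
    have hprod : ∏ r, (1 - a * x r) ≠ 0 := Finset.prod_ne_zero_iff.2 fun r _ => hax r
    have hL : ∏ r, qPoch q (a * q * x r / (b * c)) (N r) * qPoch q (a * x r) (N r + 1) /
          (qPoch q (a * q * x r / b) (N r) * qPoch q (a * q * x r / c) (N r)) =
        (∏ r, (1 - a * x r)) * ∏ r, qPoch q (a * q * x r / (b * c)) (N r) *
          qPoch q (a * q * x r) (N r) /
          (qPoch q (a * q * x r / b) (N r) * qPoch q (a * q * x r / c) (N r)) := by
      rw [← Finset.prod_mul_distrib]
      refine Finset.prod_congr rfl fun r _ => ?_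
      rw [qPoch_succ', show a * x r * q = a * q * x r by ring]
      ring
    refine mul_left_cancel₀ hprod ?_
    rw [← hL, ← h, Finset.mul_sum]
    refine Finset.sum_congr rfl fun k hk => ?_
    rw [← vandermonde_mul_div_eq_chainCoeff hq0 hx0 hx (Finset.mem_Iic.1 hk) hxq]
    have e1 : (a * q ^ (1 + size N) / (b * c)) ^ size k =
        (a * q / (b * c)) ^ size k * (q ^ size N) ^ size k := by
      rw [← mul_pow, pow_add, pow_one]
      congr 1
      ring
    have e2 : (∏ r, (1 - a * x r * q ^ (k r + size k)) * qPoch q (a * x r) (size k) /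
          (qPoch q (a * x r * q ^ (1 + N r)) (size k) *
            (qPoch q (a * q * x r / b) (k r) * qPoch q (a * q * x r / c) (k r)))) =
        (∏ r, (1 - a * x r)) * ((∏ r, (1 - a * x r * q ^ (k r + size k)) / (1 - a * x r)) *
          (∏ r, qPoch q (a * x r) (size k) /
            (qPoch q (a * x r * q ^ (1 + N r)) (size k) *
              (qPoch q (a * q * x r / b) (k r) * qPoch q (a * q * x r / c) (k r))))) := by
      simp_rw [← Finset.prod_mul_distrib]
      refine Finset.prod_congr rfl fun r _ => ?_
      rw [← mul_assoc (1 - a * x r), mul_div_cancel₀ _ (hax r), mul_div_assoc]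
    rw [e1, e2]
    ring
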